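/- Let $G$ be a connected threshold graph on $k\ge 2$ vertices, i.e. a connected graph that can be built from a single vertex by repeatedly adding either an isolated vertex or a vertex adjacent to all vertices already present. Let $L$ be its Laplacian matrix. For a real $k\times p$ matrix $B$ with rows indexed by the vertices (a $p$-input control matrix), call $(L,B)$ controllable if the system $\dot{x}=-Lx+Bu$ is controllable, that is, any initial state can be transferred to any final state in finite time by a suitable input $u$. Call $B$ binary if all its nonzero entries equal $1$, and terminal if each of its columns has exactly one nonzero entry. Let $d_1\ge\dots\ge d_k$ be the degree sequence of $G$, let $\tilde d_1>\dots>\tilde d_{\tilde k}$ be its distinct values with multiplicities $m_1,\dots,m_{\tilde k}$, and let $\tilde B_i$ be the submatrix of $B$ formed by the rows of the $m_i$ vertices of degree $\tilde d_i$. Let $d_i^*=|\{j : d_j\ge i\}|$ for $1\le i\le k$, and let $m_1^*,m_2^*,\dots$ be the multiplicities of the distinct values of the conjugate sequence $(d_1^*,\dots,d_k^*)$. Then: 1. If $(L,B)$ is controllable, then $\operatorname{rank}\tilde B_i\ge m_i-1$ for every $i\in\{1,\dots,\tilde k\}$. These bounds are the minimum: for every $p$ for which some $k\times p$ matrix makes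 the system controllable, there is a real $k\times p$ matrix $B$ such that $(L,B)$ is controllable and $\operatorname{rank}\tilde B_i=m_i-1$ for all $i$. 2. The number $\max_i m_i^*$ is the largest multiplicity of an eigenvalue of $L$. It is the minimum $p$ for which there is a real $k\times p$ matrix $B$ with $(L,B)$ controllable, and it is also the minimum $p$ for which there is such a binary $B$. 3. The minimum $p$ for which there is a terminal $k\times p$ matrix $B$ with $(L,B)$ controllable is $k-\tilde k$. -/

import Mathlib

namespace ThresholdControl

/-- The linear time-invariant system `x' = A x + B u` is controllable: for every initial state `x₀`
and every final state `x₁` there is a (continuous) input `u` that transfers `x₀` to `x₁` in some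
finite time `T`. -/
def IsControllable {ι κ : Type*} [Fintype ι] [Fintype κ]
    (A : Matrix ι ι ℝ) (B : Matrix ι κ ℝ) : Prop :=
  ∀ x₀ x₁ : ι → ℝ, ∃ T : ℝ, 0 < T ∧ ∃ u : ℝ → κ → ℝ, Continuous u ∧ ∃ x : ℝ → ι → ℝ,
    x 0 = x₀ ∧ x T = x₁ ∧ ∀ t ∈ Set.Icc (0 : ℝ) T,
      HasDerivWithinAt x (A.mulVec (x t) + B.mulVec (u t)) (Set.Icc (0 : ℝ) T) t

/-- The controlled Laplacian dynamics `x' = -L x + B u` on the graph `G` is controllable. -/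
def LaplacianControllable {V κ : Type*} [Fintype V] [DecidableEq V] [Fintype κ]
    (G : SimpleGraph V) [DecidableRel G.Adj] (B : Matrix V κ ℝ) : Prop :=
  IsControllable (-(G.lapMatrix ℝ)) B

/-- A threshold graph: the vertices can be listed as `e 0, e 1, …` and added one at a time, starting
from the single vertex `e 0`, where each further vertex `e j` is added either as a dominating vertex
of the current graph (join, `s j = true`) or as an isolated one (union, `s j = false`).
The value of `s` at the first index plays no role. -/
def IsThreshold {V : Type*} [Fintype V] (G : SimpleGraph V) : Prop :=
  ∃ (e : Fin (Fintype.card V) ≃ V) (s : Fin (Fintype.card V) → Bool),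
    ∀ i j : Fin (Fintype.card V), i < j → (G.Adj (e i) (e j) ↔ s j = true)

section DegreeData

variable {V : Type*} [Fintype V] (G : SimpleGraph V) [DecidableRel G.Adj]

/-- The set of distinct vertex degrees. -/
def distinctDegrees : Finset ℕ := Finset.univ.image fun v : V => G.degree v

/-- The number of vertices of degree `d`, i.e. the multiplicity of `d` in the degree sequence. -/
def degreeMult (d : ℕ) : ℕ := Fintype.card {v : V // G.degree v = d}

/-- The row block of `B` formed by the rows of the vertices of degree `d`. -/
def degreeBlock {κ : Type*} (B : Matrix V κ ℝ) (d : ℕ) : Matrix {v : V // G.degree v = d} κ ℝ :=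
  B.submatrix (fun v => (v : V)) id

/-- The `i`-th entry (for `1 ≤ i ≤ k`, where `k` is the number of vertices) of the conjugate of the
degree sequence: the number of vertices of degree at least `i`. -/
def conjDegree (i : ℕ) : ℕ := (Finset.univ.filter fun v : V => i ≤ G.degree v).card

/-- The multiplicity of `c` in the conjugate `(d₁*, …, d_k*)` of the degree sequence. -/
def conjMult (c : ℕ) : ℕ :=
  ((Finset.Icc 1 (Fintype.card V)).filter fun i => conjDegree G i = c).card

/-- The maximum multiplicity of an entry in the conjugate of the degree sequence. -/
def maxConjMult : ℕ :=
  (Finset.Icc 1 (Fintype.card V)).sup fun i => conjMult G (conjDegree G i)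

/-- The multiplicity of `μ` as an eigenvalue of the (real symmetric) Laplacian matrix. -/
noncomputable def lapEigenMult [DecidableEq V] (μ : ℝ) : ℕ :=
  Module.finrank ℝ (Module.End.eigenspace (Matrix.toLin' (G.lapMatrix ℝ)) μ)

end DegreeData

/-- Every nonzero entry of `B` is `1`. -/
def IsBinary {ι κ : Type*} (B : Matrix ι κ ℝ) : Prop := ∀ i j, B i j ≠ 0 → B i j = 1

/-- Every column of `B` has exactly one nonzero entry. -/
def IsTerminal {ι κ : Type*} (B : Matrix ι κ ℝ) : Prop := ∀ j, ∃! i, B i j ≠ 0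

end ThresholdControl

namespace ThresholdControl

open Matrix

/-! By the Hautus test, `(L, B)` is controllable exactly when no nonzero eigenvector `f` of `L`
satisfies `f ᵥ* B = 0`. Necessity follows a left eigenvector along a trajectory; sufficiency
(`isControllable_of_diagonalization`) inverts the controllability Gramian. What remains is to know
the eigenvectors of `L`.

A creation sequence diagonalizes `L` (`lapMatrix_mulVec_stepVec`), and the bijection `conjIndex`
identifies the step eigenvalues with the conjugate degree sequence. For connected `G`, equal
eigenvalues at steps `≥ 1` occur on runs of consecutive steps of one type. These runs are the degree
classes, except that step `0` belongs to the class of step `1`. An eigenvector for a step eigenvalue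
`μ > 0` is therefore constant before its run, zero after it, and of total sum zero (`exists_shape`).

Lower bounds: `f ↦ f ᵥ* B` is injective on each eigenspace, so `p` is at least every multiplicity.
Vertices of equal degree are twins, so zero-sum vectors on a degree class are eigenvectors; this
gives the rank bound and the terminal bound.

Upper bounds: an eigenvector vanishing at every step that is not the first of its degree class is
zero (`eq_zero_of_isRepeated`). One input per such step gives the terminal matrix. Merging inputs of
steps with equal offset in their runs (`offsetMatrix`) gives a binary matrix with as few columns as
the largest multiplicity. -/

/-! ### The Hautus test -/

/-- A left eigenvector of the state matrix which annihilates the control matrix of a controllable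
system is zero. -/
theorem IsControllable.eq_zero_of_vecMul_eq_zero {ι κ : Type*} [Fintype ι] [Fintype κ]
    {A : Matrix ι ι ℝ} {B : Matrix ι κ ℝ} (h : IsControllable A B) {v : ι → ℝ} {μ : ℝ}
    (hA : v ᵥ* A = μ • v) (hB : v ᵥ* B = 0) : v = 0 := by
  -- Steering from `0` to `v` itself: `v ⬝ᵥ x t` solves `y' = μ y` with `y 0 = 0`, so its final
  -- value `v ⬝ᵥ v` is zero.
  obtain ⟨T, hT, u, -, x, hx0, hxT, hx⟩ := h 0 v
  have hy : ∀ t ∈ Set.Icc (0 : ℝ) T,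
      HasDerivWithinAt (fun t => v ⬝ᵥ x t) (μ * (v ⬝ᵥ x t)) (Set.Icc 0 T) t := by
    intro t ht
    have h1 : HasDerivWithinAt (fun t => v ⬝ᵥ x t) (v ⬝ᵥ (A *ᵥ x t + B *ᵥ u t))
        (Set.Icc 0 T) t := by
      unfold dotProduct
      exact HasDerivWithinAt.fun_sum fun i _ =>
        ((hasDerivWithinAt_pi.1 (hx t ht)) i).const_mul (v i)
    convert h1 using 1
    rw [dotProduct_add, dotProduct_mulVec, dotProduct_mulVec, hA, hB, smul_dotProduct,
      zero_dotProduct, add_zero, smul_eq_mul]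
  have hz : ∀ t ∈ Set.Icc (0 : ℝ) T,
      HasDerivWithinAt (fun t => Real.exp (-μ * t) * (v ⬝ᵥ x t)) 0 (Set.Icc 0 T) t := by
    intro t ht
    have h2 : HasDerivWithinAt (fun t : ℝ => Real.exp (-μ * t)) (Real.exp (-μ * t) * (-μ * 1))
        (Set.Icc 0 T) t := ((hasDerivWithinAt_id t _).const_mul (-μ)).exp
    exact (h2.mul (hy t ht)).congr_deriv (by ring)
  have hc := constant_of_derivWithin_zero (fun t ht => (hz t ht).differentiableWithinAt)
    (fun t ht => (hz t (Set.Ico_subset_Icc_self ht)).derivWithin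
      (uniqueDiffOn_Icc hT t (Set.Ico_subset_Icc_self ht))) T (Set.right_mem_Icc.2 hT.le)
  simp only [hx0, hxT, dotProduct_zero, mul_zero, mul_eq_zero, Real.exp_ne_zero, false_or] at hc
  exact dotProduct_self_eq_zero.1 hc

/-- If a linear combination of exponentials vanishes on `[0, 1]`, then so does the sum of the
coefficients belonging to any fixed exponent. -/
theorem sum_filter_eq_zero_of_sum_mul_exp_eq_zero {ι : Type*} [Fintype ι] (μ b : ι → ℝ)
    (h : ∀ t ∈ Set.Icc (0 : ℝ) 1, ∑ j, b j * Real.exp (μ j * t) = 0) (m : ℝ) :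
    ∑ j with μ j = m, b j = 0 := by
  classical
  rcases isEmpty_or_nonempty ι with hι | hι
  · simp
  set S : Finset ℝ := (Finset.univ.image μ).erase m with hS
  set N : ℝ := (Fintype.card ι : ℝ) with hN
  have hNpos : 0 < N := by rw [hN]; exact_mod_cast Fintype.card_pos
  -- Sampling at the times `i / N` turns the exponentials into powers `r (μ j) ^ i`. A polynomial of
  -- degree at most `N` that vanishes at every other `r y` then isolates the exponent `m`.
  set r : ℝ → ℝ := fun y => Real.exp (y / N) with hr
  have hrinj : ∀ y z, r y = r z → y = z := fun y z hyz => by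
    have := Real.exp_injective hyz
    field_simp at this
    exact this
  set P : Polynomial ℝ := ∏ y ∈ S, (Polynomial.X - Polynomial.C (r y)) with hP
  have hdeg : P.natDegree ≤ Fintype.card ι := by
    rw [hP, Polynomial.natDegree_finsetProd_X_sub_C_eq_card]
    exact (Finset.card_le_card (Finset.erase_subset _ _)).trans Finset.card_image_le
  have h0 : ∑ j, b j * P.eval (r (μ j)) = 0 := by
    simp_rw [Polynomial.eval_eq_sum_range, Finset.mul_sum]
    rw [Finset.sum_comm]
    refine Finset.sum_eq_zero fun i hi => ?_
    have hi' : (i : ℝ) ≤ N := by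
      rw [hN]; exact_mod_cast (Nat.lt_succ_iff.1 (Finset.mem_range.1 hi)).trans hdeg
    have := h (i / N) ⟨by positivity, (div_le_one hNpos).2 hi'⟩
    calc ∑ j, b j * (P.coeff i * r (μ j) ^ i)
        = P.coeff i * ∑ j, b j * Real.exp (μ j * (i / N)) := by
          rw [Finset.mul_sum]
          refine Finset.sum_congr rfl fun j _ => ?_
          rw [hr]
          simp only
          rw [← Real.exp_nat_mul, show (i : ℝ) * (μ j / N) = μ j * (i / N) by ring]
          ring
      _ = 0 := by rw [this, mul_zero]
  have h1 : ∑ j, b j * P.eval (r (μ j)) = (∑ j with μ j = m, b j) * P.eval (r m) := by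
    rw [Finset.sum_mul, Finset.sum_filter]
    refine Finset.sum_congr rfl fun j _ => ?_
    split_ifs with hj
    · rw [hj]
    · rw [hP, Polynomial.eval_prod, Finset.prod_eq_zero (i := μ j), mul_zero]
      · exact Finset.mem_erase.2 ⟨hj, Finset.mem_image_of_mem _ (Finset.mem_univ _)⟩
      · simp
  have h2 : P.eval (r m) ≠ 0 := by
    rw [hP, Polynomial.eval_prod, Finset.prod_ne_zero_iff]
    intro y hy
    simp only [Polynomial.eval_sub, Polynomial.eval_X, Polynomial.eval_C, sub_ne_zero]
    exact fun h => (Finset.mem_erase.1 hy).1 (hrinj _ _ h).symm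
  exact (mul_eq_zero.1 (h1.symm.trans h0)).resolve_right h2

/-- The Hautus test for a diagonalizable state matrix. -/
theorem isControllable_of_diagonalization {ι κ : Type*} [Fintype ι] [DecidableEq ι] [Fintype κ]
    {A : Matrix ι ι ℝ} {B : Matrix ι κ ℝ} (Q : Matrix ι ι ℝ) (μ : ι → ℝ) (hQ : IsUnit Q)
    (hQA : Q * A = diagonal μ * Q)
    (h : ∀ (v : ι → ℝ) (m : ℝ), v ᵥ* A = m • v → v ᵥ* B = 0 → v = 0) : IsControllable A B := by
  have hdet : IsUnit Q.det := (Matrix.isUnit_iff_isUnit_det Q).1 hQ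
  set C : Matrix ι κ ℝ := Q * B with hC
  -- the input with costate `a`
  set U : (ι → ℝ) → ℝ → κ → ℝ := fun a t l => ∑ i, a i * Real.exp (-μ i * t) * C i l with hU
  have hUc : ∀ a, Continuous (U a) := fun a => by rw [hU]; fun_prop
  have hint : ∀ a j, Continuous fun t => Real.exp (-μ j * t) * (C *ᵥ U a t) j := fun a j => by
    have := hUc a
    unfold Matrix.mulVec dotProduct
    fun_prop
  -- The controllability Gramian on `[0, 1]` in the eigencoordinates `Q x`. Injectivity makes it
  -- surjective, and a preimage gives the steering input.
  set Φ : (ι → ℝ) → ι → ℝ :=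
    fun a j => ∫ t in (0 : ℝ)..1, Real.exp (-μ j * t) * (C *ᵥ U a t) j with hΦ
  have hUadd : ∀ a b t, U (a + b) t = U a t + U b t := fun a b t => by
    ext l; simp [hU, add_mul, Finset.sum_add_distrib]
  have hUsmul : ∀ (r : ℝ) a t, U (r • a) t = r • U a t := fun r a t => by
    ext l; simp [hU, Finset.mul_sum, mul_assoc]
  let Ψ : (ι → ℝ) →ₗ[ℝ] (ι → ℝ) :=
    { toFun := Φ
      map_add' := fun a b => by
        ext j
        simp only [hΦ, Pi.add_apply]
        rw [← intervalIntegral.integral_add ((hint a j).intervalIntegrable _ _)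
          ((hint b j).intervalIntegrable _ _)]
        refine intervalIntegral.integral_congr fun t _ => ?_
        simp only [hUadd, mulVec_add, Pi.add_apply, mul_add]
      map_smul' := fun r a => by
        ext j
        simp only [hΦ, Pi.smul_apply, smul_eq_mul, RingHom.id_apply]
        rw [← intervalIntegral.integral_const_mul]
        refine intervalIntegral.integral_congr fun t _ => ?_
        simp only [hUsmul, mulVec_smul, Pi.smul_apply, smul_eq_mul]
        ring }
  have hinj : Function.Injective Ψ := by
    rw [← LinearMap.ker_eq_bot, LinearMap.ker_eq_bot']
    intro a ha
    have ha' : ∀ j, Φ a j = 0 := fun j => congrFun ha j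
    -- The quadratic form of the Gramian at `a` is the energy of the input `U a`.
    have hsq : ∫ t in (0 : ℝ)..1, U a t ⬝ᵥ U a t = 0 := by
      calc ∫ t in (0 : ℝ)..1, U a t ⬝ᵥ U a t
          = ∫ t in (0 : ℝ)..1, ∑ j, a j * (Real.exp (-μ j * t) * (C *ᵥ U a t) j) := by
            refine intervalIntegral.integral_congr fun t _ => ?_
            change (fun i => a i * Real.exp (-μ i * t)) ᵥ* C ⬝ᵥ U a t = _
            rw [← dotProduct_mulVec]
            exact Finset.sum_congr rfl fun j _ => mul_assoc _ _ _
        _ = ∑ j, a j * Φ a j := by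
            rw [intervalIntegral.integral_finsetSum fun j _ =>
              ((hint a j).const_mul (a j)).intervalIntegrable _ _]
            simp_rw [intervalIntegral.integral_const_mul]
            rfl
        _ = 0 := by simp [ha']
    have hcont : Continuous fun t => U a t ⬝ᵥ U a t := by
      have := hUc a
      unfold dotProduct
      fun_prop
    have hUzero : ∀ t ∈ Set.Icc (0 : ℝ) 1, U a t = 0 := by
      intro t ht
      by_contra hne
      have hpos : 0 < ∫ t in (0 : ℝ)..1, U a t ⬝ᵥ U a t := by
        refine intervalIntegral.integral_pos one_pos hcont.continuousOn
          (fun t _ => Finset.sum_nonneg fun i _ => mul_self_nonneg _) ⟨t, ht, ?_⟩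
        exact lt_of_le_of_ne (Finset.sum_nonneg fun i _ => mul_self_nonneg _)
          fun h0 => hne (dotProduct_self_eq_zero.1 h0.symm)
      exact hpos.ne' hsq
    have hgroup : ∀ (m : ℝ) l, ∑ j with μ j = m, a j * C j l = 0 := by
      intro m l
      have := sum_filter_eq_zero_of_sum_mul_exp_eq_zero (fun j => -μ j) (fun j => a j * C j l)
        (fun t ht => by
          refine Eq.trans ?_ (congrFun (hUzero t ht) l)
          exact Finset.sum_congr rfl fun j _ => by ring) (-m)
      simpa using this
    ext j
    -- The part of `a` on one eigenvalue: `a' ᵥ* Q` is a left eigenvector of `A`, and `hgroup` says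
    -- that `B` annihilates it.
    set a' : ι → ℝ := fun i => if μ i = μ j then a i else 0 with ha'
    have hv : a' ᵥ* Q = 0 := by
      apply h (a' ᵥ* Q) (μ j)
      · rw [vecMul_vecMul, hQA, ← vecMul_vecMul, ← smul_vecMul]
        congr 1
        ext i
        rw [vecMul_diagonal]
        simp only [ha', Pi.smul_apply, smul_eq_mul]
        split_ifs with hi
        · rw [hi, mul_comm]
        · simp
      · rw [vecMul_vecMul, ← hC]
        ext l
        refine Eq.trans ?_ (hgroup (μ j) l)
        rw [Finset.sum_filter]
        refine Finset.sum_congr rfl fun i _ => ?_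
        simp only [ha']
        split_ifs <;> simp
    have := congrFun (Matrix.vecMul_injective_iff_isUnit.2 hQ (hv.trans (zero_vecMul Q).symm)) j
    simpa [ha'] using this
  have hsurj : Function.Surjective Ψ := LinearMap.injective_iff_surjective.1 hinj
  intro x₀ x₁
  obtain ⟨a, ha⟩ := hsurj fun j => Real.exp (-μ j) * (Q *ᵥ x₁) j - (Q *ᵥ x₀) j
  have ha' : ∀ j, Φ a j = Real.exp (-μ j) * (Q *ᵥ x₁) j - (Q *ᵥ x₀) j := fun j => congrFun ha j
  -- Variation of constants in the coordinates `Q x`; the choice of `a` makes `y 1 = Q *ᵥ x₁`.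
  set y : ℝ → ι → ℝ := fun t j => Real.exp (μ j * t) *
    ((Q *ᵥ x₀) j + ∫ τ in (0 : ℝ)..t, Real.exp (-μ j * τ) * (C *ᵥ U a τ) j) with hy
  have hyd : ∀ t j, HasDerivAt (fun t => y t j) ((diagonal μ *ᵥ y t + C *ᵥ U a t) j) t := by
    intro t j
    have h1 : HasDerivAt (fun t : ℝ => Real.exp (μ j * t)) (Real.exp (μ j * t) * (μ j * 1)) t :=
      ((hasDerivAt_id t).const_mul (μ j)).exp
    have h2 := ((hint a j).integral_hasStrictDerivAt 0 t).hasDerivAt.const_add ((Q *ᵥ x₀) j)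
    refine (h1.mul h2).congr_deriv ?_
    have h3 : Real.exp (μ j * t) * Real.exp (-μ j * t) = 1 := by
      rw [← Real.exp_add, show μ j * t + -μ j * t = 0 by ring, Real.exp_zero]
    rw [Pi.add_apply, mulVec_diagonal]
    simp only [hy]
    linear_combination (C *ᵥ U a t) j * h3
  refine ⟨1, one_pos, U a, hUc a, fun t => Q⁻¹ *ᵥ y t, ?_, ?_, ?_⟩
  · have : y 0 = Q *ᵥ x₀ := by ext j; simp [hy]
    simp only [this]
    rw [mulVec_mulVec, nonsing_inv_mul Q hdet, one_mulVec]
  · have : y 1 = Q *ᵥ x₁ := by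
      ext j
      have := ha' j
      simp only [hΦ] at this
      simp only [hy]
      rw [this, add_sub_cancel, ← mul_assoc, ← Real.exp_add]
      simp
    simp only [this]
    rw [mulVec_mulVec, nonsing_inv_mul Q hdet, one_mulVec]
  · intro t _
    apply HasDerivAt.hasDerivWithinAt
    have h1 : HasDerivAt (fun t => Q⁻¹ *ᵥ y t) (Q⁻¹ *ᵥ (diagonal μ *ᵥ y t + C *ᵥ U a t)) t := by
      rw [hasDerivAt_pi]
      intro i
      unfold Matrix.mulVec dotProduct
      exact HasDerivAt.fun_sum fun j _ => (hyd t j).const_mul _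
    refine h1.congr_deriv ?_
    have h2 : Q⁻¹ * diagonal μ = A * Q⁻¹ := by
      calc Q⁻¹ * diagonal μ = Q⁻¹ * (diagonal μ * Q) * Q⁻¹ := by
            rw [Matrix.mul_assoc, Matrix.mul_assoc, mul_nonsing_inv Q hdet, Matrix.mul_one]
        _ = A * Q⁻¹ := by
            rw [← hQA, ← Matrix.mul_assoc, nonsing_inv_mul Q hdet, Matrix.one_mul]
    rw [mulVec_add, mulVec_mulVec, mulVec_mulVec, mulVec_mulVec, h2, hC, ← Matrix.mul_assoc,
      nonsing_inv_mul Q hdet, Matrix.one_mul]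

/-! ### Degrees and eigenvalues along a creation sequence -/

/-- The number of joins among the steps `1, …, j` of a creation sequence. -/
def joinCount (s : ℕ → Bool) (j : ℕ) : ℕ := ((Finset.Ioc 0 j).filter fun i => s i = true).card

/-- The number of unions among the steps `1, …, j` of a creation sequence. -/
def unionCount (s : ℕ → Bool) (j : ℕ) : ℕ := ((Finset.Ioc 0 j).filter fun i => ¬ s i = true).card

/-- The degree of the vertex added in step `j ≤ N` in the graph created by the steps `0, …, N`. -/
def stepDegree (s : ℕ → Bool) (N j : ℕ) : ℕ :=
  if s j = true then joinCount s N + unionCount s j else joinCount s N - joinCount s j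

/-- The Laplacian eigenvalue of the graph created by the steps `0, …, N` that belongs to the
eigenvector equal to `1` before step `j`, to `-j` at step `j` and to `0` after it; for `j = 0` the
eigenvalue of the constant vector. -/
def stepEigenvalue (s : ℕ → Bool) (N j : ℕ) : ℕ :=
  if j = 0 then 0 else
    if s j = true then joinCount s N + 1 + unionCount s j else joinCount s N - joinCount s j

section CreationSequence

variable (s : ℕ → Bool) (N : ℕ)

@[simp] theorem joinCount_zero : joinCount s 0 = 0 := by simp [joinCount]

@[simp] theorem unionCount_zero : unionCount s 0 = 0 := by simp [unionCount]

theorem joinCount_succ (j : ℕ) :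
    joinCount s (j + 1) = joinCount s j + if s (j + 1) = true then 1 else 0 := by
  have : Finset.Ioc 0 (j + 1) = insert (j + 1) (Finset.Ioc 0 j) := by ext; simp; omega
  rw [joinCount, this, Finset.filter_insert]
  split_ifs with h
  · rw [Finset.card_insert_of_notMem (by simp), joinCount]
  · rfl

theorem unionCount_succ (j : ℕ) :
    unionCount s (j + 1) = unionCount s j + if s (j + 1) = true then 0 else 1 := by
  have : Finset.Ioc 0 (j + 1) = insert (j + 1) (Finset.Ioc 0 j) := by ext; simp; omega
  rw [unionCount, this, Finset.filter_insert]
  split_ifs with h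
  · rfl
  · rw [Finset.card_insert_of_notMem (by simp), unionCount]

theorem joinCount_add_unionCount (j : ℕ) : joinCount s j + unionCount s j = j := by
  rw [joinCount, unionCount, Finset.card_filter_add_card_filter_not]
  simp

theorem joinCount_mono {i j : ℕ} (h : i ≤ j) : joinCount s i ≤ joinCount s j :=
  Finset.card_le_card (Finset.filter_subset_filter _ (Finset.Ioc_subset_Ioc_right h))

theorem unionCount_mono {i j : ℕ} (h : i ≤ j) : unionCount s i ≤ unionCount s j :=
  Finset.card_le_card (Finset.filter_subset_filter _ (Finset.Ioc_subset_Ioc_right h))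

theorem card_join_filter (q : ℕ) (hq : q ≤ N) :
    ((Finset.range (N + 1)).filter fun l => q < l ∧ s l = true).card
      = joinCount s N - joinCount s q := by
  have h1 : (Finset.Ioc 0 q).filter (fun i => s i = true) ⊆
      (Finset.Ioc 0 N).filter (fun i => s i = true) :=
    Finset.filter_subset_filter _ (Finset.Ioc_subset_Ioc_right hq)
  rw [joinCount, joinCount, ← Finset.card_sdiff_of_subset h1]
  congr 1
  ext l
  simp only [Finset.mem_filter, Finset.mem_range, Finset.mem_sdiff, Finset.mem_Ioc]
  constructor
  · rintro ⟨h1, h2, h3⟩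
    exact ⟨⟨by omega, h3⟩, fun h => by omega⟩
  · rintro ⟨⟨h1, h2⟩, h3⟩
    refine ⟨by omega, ?_, h2⟩
    by_contra h
    exact h3 ⟨by omega, h2⟩

variable {s N}

/-- The final join comes after every union step, so it is still counted in `joinCount s N -
joinCount s j`. -/
theorem stepEigenvalue_pos (hN : s N = true) {j : ℕ} (h1 : 1 ≤ j) (h2 : j ≤ N) :
    0 < stepEigenvalue s N j := by
  unfold stepEigenvalue
  split_ifs with h3 h4
  · omega
  · omega
  · obtain ⟨N, rfl⟩ : ∃ M, N = M + 1 := ⟨N - 1, by omega⟩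
    have h5 : j ≠ N + 1 := by rintro rfl; exact h4 hN
    have := joinCount_mono s (show j ≤ N by omega)
    have h6 := joinCount_succ s N
    rw [if_pos hN] at h6
    omega

/-- Steps with the same eigenvalue form an interval. -/
theorem stepEigenvalue_eq_succ {i j : ℕ} (h1 : 1 ≤ i) (hij : i ≤ j) (hj : j + 1 ≤ N)
    (h : stepEigenvalue s N i = stepEigenvalue s N (j + 1)) :
    stepEigenvalue s N j = stepEigenvalue s N (j + 1) := by
  rcases hij.eq_or_lt with rfl | hlt
  · exact h
  obtain ⟨k, rfl⟩ : ∃ k, j = k + 1 := ⟨j - 1, by omega⟩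
  obtain ⟨i, rfl⟩ : ∃ k, i = k + 1 := ⟨i - 1, by omega⟩
  have c1 := joinCount_mono s (show i + 1 ≤ k by omega)
  have c2 := joinCount_mono s (show k + 1 + 1 ≤ N by omega)
  have u1 := unionCount_mono s (show i + 1 ≤ k by omega)
  have a1 := joinCount_succ s i
  have a2 := joinCount_succ s k
  have a3 := joinCount_succ s (k + 1)
  have b1 := unionCount_succ s i
  have b2 := unionCount_succ s k
  have b3 := unionCount_succ s (k + 1)
  unfold stepEigenvalue at *
  split_ifs at * <;> omega

/-- Consecutive steps with the same eigenvalue have the same degree. -/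
theorem stepDegree_eq_of_stepEigenvalue_eq {j : ℕ} (h1 : 1 ≤ j) (hj : j + 1 ≤ N)
    (h : stepEigenvalue s N j = stepEigenvalue s N (j + 1)) :
    stepDegree s N j = stepDegree s N (j + 1) := by
  obtain ⟨k, rfl⟩ : ∃ k, j = k + 1 := ⟨j - 1, by omega⟩
  have c2 := joinCount_mono s (show k + 1 + 1 ≤ N by omega)
  have a2 := joinCount_succ s k
  have a3 := joinCount_succ s (k + 1)
  have b2 := unionCount_succ s k
  have b3 := unionCount_succ s (k + 1)
  unfold stepEigenvalue at h
  unfold stepDegree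
  split_ifs at * <;> omega

/-- Both degrees are `joinCount s N`, whatever the types of the two steps; in particular `s 0` is
irrelevant. -/
theorem stepDegree_zero_eq_one (hN : 1 ≤ N) : stepDegree s N 0 = stepDegree s N 1 := by
  have c2 := joinCount_mono s hN
  have a2 := joinCount_succ s 0
  have b2 := unionCount_succ s 0
  have a3 := joinCount_zero s
  have b3 := unionCount_zero s
  unfold stepDegree
  split_ifs at * <;> simp_all

/-- A change of type from step `j` to step `j + 1` creates a degree that no earlier step has. A
recurring degree thus forces equal types, and consecutive steps of equal type share their
eigenvalue. -/
theorem stepEigenvalue_eq_of_stepDegree_eq {i j : ℕ} (hij : i ≤ j) (h1 : 1 ≤ j) (hj : j + 1 ≤ N)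
    (h : stepDegree s N i = stepDegree s N (j + 1)) :
    stepEigenvalue s N j = stepEigenvalue s N (j + 1) := by
  obtain ⟨k, rfl⟩ : ∃ k, j = k + 1 := ⟨j - 1, by omega⟩
  have c2 := joinCount_mono s (show k + 1 + 1 ≤ N by omega)
  have a2 := joinCount_succ s k
  have a3 := joinCount_succ s (k + 1)
  have b2 := unionCount_succ s k
  have b3 := unionCount_succ s (k + 1)
  unfold stepEigenvalue
  unfold stepDegree at h
  rcases hij.eq_or_lt with rfl | hlt
  · split_ifs at * <;> omega
  have c1 := joinCount_mono s (show i ≤ k by omega)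
  have u1 := unionCount_mono s (show i ≤ k by omega)
  rcases Nat.eq_zero_or_pos i with rfl | hi
  · have a4 := joinCount_zero s
    have b4 := unionCount_zero s
    split_ifs at * <;> omega
  obtain ⟨i, rfl⟩ : ∃ k, i = k + 1 := ⟨i - 1, by omega⟩
  have a1 := joinCount_succ s i
  have b1 := unionCount_succ s i
  split_ifs at * <;> omega

/-- Steps with the same degree form an interval. -/
theorem stepDegree_eq_of_between {i l j : ℕ} (hil : i ≤ l) (hlj : l ≤ j) (hj : j ≤ N)
    (h : stepDegree s N i = stepDegree s N j) : stepDegree s N l = stepDegree s N j := by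
  induction j, hlj using Nat.le_induction with
  | base => rfl
  | succ j hlj ih =>
    have key : stepDegree s N j = stepDegree s N (j + 1) := by
      rcases Nat.eq_zero_or_pos j with rfl | h1
      · exact stepDegree_zero_eq_one hj
      · exact stepDegree_eq_of_stepEigenvalue_eq h1 hj
          (stepEigenvalue_eq_of_stepDegree_eq (hil.trans hlj) h1 hj h)
    rw [← key] at h ⊢
    exact ih (by omega) h

theorem step_eq_of_stepDegree_eq {i j : ℕ} (h1 : 1 ≤ i) (hij : i ≤ j) (hj : j ≤ N)
    (h : stepDegree s N i = stepDegree s N j) : s i = s j := by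
  have c1 := joinCount_mono s hij
  have c2 := joinCount_mono s hj
  have u1 := unionCount_mono s hij
  obtain ⟨i, rfl⟩ : ∃ k, i = k + 1 := ⟨i - 1, by omega⟩
  obtain ⟨j, rfl⟩ : ∃ k, j = k + 1 := ⟨j - 1, by omega⟩
  have a1 := joinCount_succ s i
  have b1 := unionCount_succ s i
  have a2 := joinCount_succ s j
  have b2 := unionCount_succ s j
  unfold stepDegree at h
  rw [Bool.eq_iff_iff]
  split_ifs at * <;> simp_all <;> omega

/-! ### The conjugate degree sequence -/

/-- The position in the conjugate degree sequence of the eigenvalue belonging to a step. -/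
def conjIndex (s : ℕ → Bool) (N j : ℕ) : ℕ :=
  if j = 0 then N + 1 else
    if s j = true then joinCount s N - joinCount s j + 1 else joinCount s N + unionCount s j

theorem conjIndex_mem {j : ℕ} (hj : j ≤ N) : conjIndex s N j ∈ Finset.Icc 1 (N + 1) := by
  have c1 := joinCount_mono s hj
  have u1 := unionCount_mono s hj
  have cu := joinCount_add_unionCount s N
  unfold conjIndex
  rw [Finset.mem_Icc]
  rcases Nat.eq_zero_or_pos j with rfl | hj'
  · simp
  obtain ⟨j, rfl⟩ : ∃ k, j = k + 1 := ⟨j - 1, by omega⟩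
  have b2 := unionCount_succ s j
  split_ifs at * <;> omega

/-- Joins occupy `1, …, joinCount s N` in decreasing order, unions the following indices up to `N`
in increasing order, and step `0` the index `N + 1`. -/
theorem conjIndex_ne {i j : ℕ} (hij : i < j) (hj : j ≤ N) :
    conjIndex s N i ≠ conjIndex s N j := by
  have cu := joinCount_add_unionCount s N
  have c2 := joinCount_mono s hj
  have u2 := unionCount_mono s hj
  obtain ⟨j, rfl⟩ : ∃ k, j = k + 1 := ⟨j - 1, by omega⟩
  have c1 := joinCount_mono s (show i ≤ j by omega)
  have u1 := unionCount_mono s (show i ≤ j by omega)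
  have a2 := joinCount_succ s j
  have b2 := unionCount_succ s j
  unfold conjIndex
  rcases Nat.eq_zero_or_pos i with rfl | hi
  · split_ifs at * <;> omega
  obtain ⟨i, rfl⟩ : ∃ k, i = k + 1 := ⟨i - 1, by omega⟩
  have a1 := joinCount_succ s i
  have b1 := unionCount_succ s i
  split_ifs at * <;> omega

/-- The Laplacian eigenvalues are the entries of the conjugate degree sequence. -/
theorem card_conjIndex_le_stepDegree {j : ℕ} (hj : j ≤ N) :
    ((Finset.range (N + 1)).filter fun l => conjIndex s N j ≤ stepDegree s N l).card
      = stepEigenvalue s N j := by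
  have cu := joinCount_add_unionCount s N
  have hmem := conjIndex_mem (s := s) hj
  rw [Finset.mem_Icc] at hmem
  rcases Nat.eq_zero_or_pos j with rfl | hj0
  · rw [Finset.filter_eq_empty_iff.2]
    · simp [stepEigenvalue]
    · intro l hl
      have u2 := unionCount_mono s (Nat.lt_succ_iff.1 (Finset.mem_range.1 hl))
      simp only [conjIndex, stepDegree, if_true]
      split_ifs <;> omega
  obtain ⟨k, rfl⟩ : ∃ k, j = k + 1 := ⟨j - 1, by omega⟩
  have a1 := joinCount_succ s k
  have b1 := unionCount_succ s k
  have cuj := joinCount_add_unionCount s (k + 1)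
  have c2 := joinCount_mono s hj
  by_cases hs : s (k + 1) = true
  -- An earlier union still receives the join `k + 1`, so it reaches the threshold; a later union
  -- misses it.
  · have : (Finset.range (N + 1)).filter (fun l => conjIndex s N (k + 1) ≤ stepDegree s N l)
        = Finset.range (k + 2) ∪
          (Finset.range (N + 1)).filter fun l => k + 1 < l ∧ s l = true := by
      ext l
      simp only [Finset.mem_filter, Finset.mem_union, Finset.mem_range]
      have d4 : l < N + 1 → joinCount s l ≤ joinCount s N := fun h => joinCount_mono s (by omega)
      simp only [conjIndex, stepDegree, hs, if_true, Nat.succ_ne_zero, if_false] at a1 b1 ⊢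
      rcases lt_trichotomy l (k + 1) with h | rfl | h
      · have d1 := joinCount_mono s (show l ≤ k by omega)
        split_ifs <;> omega
      · simp only [hs, if_true, and_true]
        omega
      · have d2 := joinCount_mono s h.le
        split_ifs with hl
        · simp only [hl, and_true]
          omega
        · simp only [hl, Bool.false_eq_true, and_false, or_false]
          omega
    rw [this, Finset.card_union_of_disjoint, card_join_filter s N _ hj, Finset.card_range]
    · simp only [stepEigenvalue, hs, if_true]
      simp
      omega
    · rw [Finset.disjoint_left]
      intro l hl hl'
      simp at hl hl'
      omega
  · have : (Finset.range (N + 1)).filter (fun l => conjIndex s N (k + 1) ≤ stepDegree s N l)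
        = (Finset.range (N + 1)).filter fun l => k + 1 < l ∧ s l = true := by
      ext l
      simp only [Finset.mem_filter, Finset.mem_range]
      simp only [conjIndex, stepDegree, hs, Bool.false_eq_true, Nat.succ_ne_zero, if_false]
        at a1 b1 ⊢
      rcases lt_trichotomy l (k + 1) with h | rfl | h
      · have d1 := unionCount_mono s (show l ≤ k by omega)
        split_ifs <;> omega
      · simp only [hs, Bool.false_eq_true, if_false, and_false, iff_false]
        omega
      · have d2 := unionCount_mono s h.le
        split_ifs with hl
        · simp only [hl, and_true]
          omega
        · simp only [hl, Bool.false_eq_true, and_false, iff_false]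
          omega
    rw [this, card_join_filter s N _ hj]
    simp [stepEigenvalue, hs]

end CreationSequence

/-! ### Step vectors and partial sums -/

/-- Entry `j` of the Laplacian eigenvector belonging to step `m` of a creation sequence. -/
def stepVec (m j : ℕ) : ℝ :=
  if m = 0 then 1 else if j < m then 1 else if j = m then -(m : ℝ) else 0

theorem sum_stepVec_mul {m : ℕ} (hm : 1 ≤ m) (g : ℕ → ℝ) {i : ℕ} (hi : m < i) :
    ∑ j ∈ Finset.range i, stepVec m j * g j = ∑ j ∈ Finset.range m, g j - m * g m := by
  induction i, hi using Nat.le_induction with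
  | base =>
    rw [Finset.sum_range_succ, sub_eq_add_neg]
    congr 1
    · refine Finset.sum_congr rfl fun j hj => ?_
      rw [stepVec, if_neg (by omega), if_pos (Finset.mem_range.1 hj), one_mul]
    · rw [stepVec, if_neg (by omega), if_neg (by omega), if_pos rfl, neg_mul]
  | succ i hi ih =>
    rw [Finset.sum_range_succ, ih, stepVec, if_neg (by omega), if_neg (by omega),
      if_neg (by omega), zero_mul, add_zero]

/-- Orthogonality to the step vectors makes each entry the mean of its predecessors. -/
theorem eq_of_sum_range_eq_mul {g : ℕ → ℝ} {a : ℕ}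
    (h : ∀ m, 1 ≤ m → m < a → ∑ j ∈ Finset.range m, g j = m * g m) (j : ℕ) (hj : j < a) :
    g j = g 0 := by
  induction j using Nat.strong_induction_on with
  | _ j ih =>
    rcases Nat.eq_zero_or_pos j with rfl | hj0
    · rfl
    have h1 := h j hj0 hj
    rw [Finset.sum_congr rfl (g := fun _ => g 0) fun i hi => ih i (Finset.mem_range.1 hi)
      ((Finset.mem_range.1 hi).trans hj), Finset.sum_const, Finset.card_range, nsmul_eq_mul] at h1
    exact (mul_left_cancel₀ (Nat.cast_ne_zero.2 hj0.ne') h1).symm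

/-- The relation at `m` turns the partial sum through `m` into `(m + 1) * g m`, so vanishing sums
propagate downwards from `N`. -/
theorem eq_zero_of_sum_range_eq_mul {g : ℕ → ℝ} {N : ℕ}
    (h0 : ∑ j ∈ Finset.range (N + 1), g j = 0) {b : ℕ}
    (h : ∀ m, b ≤ m → m ≤ N → ∑ j ∈ Finset.range m, g j = m * g m) (m : ℕ) (hm : b ≤ m)
    (hmN : m ≤ N) : g m = 0 := by
  have key : ∀ k m, m + k = N → b ≤ m → ∑ j ∈ Finset.range (m + 1), g j = 0 ∧ g m = 0 := by
    intro k
    induction k with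
    | zero =>
      rintro m rfl hb
      refine ⟨h0, ?_⟩
      rw [add_zero, Finset.sum_range_succ, h m hb le_rfl, ← add_one_mul] at h0
      exact (mul_eq_zero.1 h0).resolve_left (by positivity)
    | succ k ih =>
      intro m hm hb
      obtain ⟨h1, h2⟩ := ih (m + 1) (by omega) (by omega)
      rw [Finset.sum_range_succ, h2, add_zero] at h1
      refine ⟨h1, ?_⟩
      rw [Finset.sum_range_succ, h m hb (by omega), ← add_one_mul] at h1
      exact (mul_eq_zero.1 h1).resolve_left (by positivity)
  exact (key (N - m) m (by omega) hm).2

/-! ### Threshold graphs: degrees and Laplacian eigenvectors -/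

/-- The steps `0, …, N` at the positions `pos` with types `s` create the graph `G`. -/
structure IsCreation {V : Type*} (G : SimpleGraph V) (pos : V → ℕ) (s : ℕ → Bool) (N : ℕ) :
    Prop where
  inj : Function.Injective pos
  le : ∀ v, pos v ≤ N
  surj : ∀ j ≤ N, ∃ v, pos v = j
  adj : ∀ u v, pos u < pos v → (G.Adj u v ↔ s (pos v) = true)

theorem IsThreshold.exists_isCreation {V : Type*} [Fintype V] {G : SimpleGraph V}
    (h : IsThreshold G) (hcard : 2 ≤ Fintype.card V) :
    ∃ pos s N, IsCreation G pos s N ∧ Fintype.card V = N + 1 ∧ 1 ≤ N := by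
  obtain ⟨e, s, hs⟩ := h
  refine ⟨fun v => e.symm v, fun j => if h : j < Fintype.card V then s ⟨j, h⟩ else false,
    Fintype.card V - 1, ⟨fun u v huv => ?_, fun v => ?_, fun j hj => ?_, fun u v huv => ?_⟩,
    by omega, by omega⟩
  · exact e.symm.injective (Fin.ext huv)
  · have := (e.symm v).2
    change (e.symm v : ℕ) ≤ _
    omega
  · exact ⟨e ⟨j, by omega⟩, by simp⟩
  · have := hs (e.symm u) (e.symm v) huv
    simpa using this

namespace IsCreation

variable {V : Type*} {G : SimpleGraph V} {pos : V → ℕ} {s : ℕ → Bool} {N : ℕ}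

theorem adj_iff (h : IsCreation G pos s N) (u v : V) :
    G.Adj u v ↔ (pos v < pos u ∧ s (pos u) = true) ∨ (pos u < pos v ∧ s (pos v) = true) := by
  rcases lt_trichotomy (pos u) (pos v) with huv | huv | huv
  · simp [h.adj u v huv, huv, huv.le]
  · simp [h.inj huv]
  · rw [G.adj_comm]
    simp [h.adj v u huv, huv, huv.le]

/-- Vectors on `V` are transported to sequences along `pos`, where the partial-sum lemmas apply. -/
theorem extend_apply (h : IsCreation G pos s N) (f : V → ℝ) (v : V) :
    Function.extend pos f 0 (pos v) = f v := h.inj.extend_apply _ _ _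

theorem step_last (h : IsCreation G pos s N) (hN : 1 ≤ N) (hconn : G.Connected) :
    s N = true := by
  obtain ⟨v, hv⟩ := h.surj N le_rfl
  obtain ⟨u, hu⟩ := h.surj 0 (by omega)
  have : Nontrivial V := ⟨u, v, fun huv => by subst huv; omega⟩
  obtain ⟨w, hw⟩ := hconn.preconnected.exists_adj_of_nontrivial v
  have := h.le w
  rw [h.adj_iff] at hw
  rcases hw with hw | hw
  · rw [← hv]; exact hw.2
  · omega

variable [Fintype V]

theorem image_pos (h : IsCreation G pos s N) :
    Finset.univ.image pos = Finset.range (N + 1) := by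
  ext j
  simp only [Finset.mem_image, Finset.mem_univ, true_and, Finset.mem_range, Nat.lt_succ_iff]
  exact ⟨by rintro ⟨v, rfl⟩; exact h.le v, h.surj j⟩

theorem sum_comp {M : Type*} [AddCommMonoid M] (h : IsCreation G pos s N) (g : ℕ → M) :
    ∑ v, g (pos v) = ∑ j ∈ Finset.range (N + 1), g j := by
  rw [← h.image_pos, Finset.sum_image fun _ _ _ _ huv => h.inj huv]

theorem card_filter_comp (h : IsCreation G pos s N) (P : ℕ → Prop) [DecidablePred P] :
    (Finset.univ.filter fun v => P (pos v)).card
      = ((Finset.range (N + 1)).filter P).card := by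
  rw [Finset.card_filter, Finset.card_filter, h.sum_comp fun j => if P j then 1 else 0]

variable [DecidableRel G.Adj]

theorem degree_eq (h : IsCreation G pos s N) (v : V) :
    G.degree v = stepDegree s N (pos v) := by
  have hle := h.le v
  have hj := joinCount_mono s hle
  have hcu := joinCount_add_unionCount s (pos v)
  have h1 : G.degree v = ((Finset.range (N + 1)).filter fun l =>
      (l < pos v ∧ s (pos v) = true) ∨ (pos v < l ∧ s l = true)).card := by
    rw [← h.card_filter_comp, ← G.card_neighborFinset_eq_degree]
    congr 1
    ext w
    simp [h.adj_iff]
  rw [h1, Finset.filter_or, Finset.card_union_of_disjoint, card_join_filter s N _ hle]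
  · by_cases hs : s (pos v) = true
    · have : (Finset.range (N + 1)).filter (fun l => l < pos v ∧ s (pos v) = true)
          = Finset.range (pos v) := by
        ext l
        simp only [Finset.mem_filter, Finset.mem_range, hs, and_true]
        omega
      rw [this, Finset.card_range, stepDegree, if_pos hs]
      omega
    · simp [hs, stepDegree]
  · rw [Finset.disjoint_left]
    intro l hl hl'
    simp at hl hl'
    omega

variable [DecidableEq V]

theorem lapMatrix_mulVec_comp (h : IsCreation G pos s N) (g : ℕ → ℝ) (v : V) :
    (G.lapMatrix ℝ *ᵥ fun u => g (pos u)) v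
      = (if s (pos v) = true then ∑ j ∈ Finset.range (pos v), (g (pos v) - g j) else 0)
        + ∑ j ∈ (Finset.range (N + 1)).filter (fun l => pos v < l ∧ s l = true),
            (g (pos v) - g j) := by
  have hle := h.le v
  have h1 : (G.lapMatrix ℝ *ᵥ fun u => g (pos u)) v
      = ∑ u ∈ G.neighborFinset v, (g (pos v) - g (pos u)) := by
    rw [SimpleGraph.lapMatrix_mulVec_apply, Finset.sum_sub_distrib, Finset.sum_const,
      G.card_neighborFinset_eq_degree, nsmul_eq_mul]
  have h2 : G.neighborFinset v = Finset.univ.filter fun u =>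
      (pos u < pos v ∧ s (pos v) = true) ∨ (pos v < pos u ∧ s (pos u) = true) := by
    ext u; simp [h.adj_iff]
  rw [h1, h2, Finset.sum_filter, h.sum_comp fun j => if (j < pos v ∧ s (pos v) = true) ∨
    (pos v < j ∧ s j = true) then g (pos v) - g j else 0, ← Finset.sum_filter, Finset.filter_or,
    Finset.sum_union]
  · congr 1
    split_ifs with hs
    · refine Finset.sum_congr ?_ fun _ _ => rfl
      ext l
      simp only [Finset.mem_filter, Finset.mem_range, hs, and_true]
      omega
    · simp [hs]
  · rw [Finset.disjoint_left]
    intro l hl hl'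
    simp at hl hl'
    omega

/-- Before step `m`, a vertex differs only from step `m`, by `m + 1`, and from later steps, by `1`;
only joins among these are its neighbours. After step `m`, the entry is `0` and the entries of the
preceding vertices sum to zero. -/
theorem lapMatrix_mulVec_stepVec (h : IsCreation G pos s N) {m : ℕ} (hm : m ≤ N) :
    (G.lapMatrix ℝ *ᵥ fun u => stepVec m (pos u))
      = (stepEigenvalue s N m : ℝ) • fun u => stepVec m (pos u) := by
  ext v
  rw [h.lapMatrix_mulVec_comp]
  rcases Nat.eq_zero_or_pos m with rfl | hm0
  · simp [stepVec, stepEigenvalue]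
  have hjm := joinCount_mono s hm
  have hcu := joinCount_add_unionCount s m
  have hev : (stepEigenvalue s N m : ℝ)
      = (if s m = true then (m : ℝ) + 1 else 0) + ((joinCount s N - joinCount s m : ℕ) : ℝ) := by
    unfold stepEigenvalue
    rw [if_neg (by omega)]
    split_ifs with hs
    · norm_cast
      omega
    · rw [zero_add]
  have hlow : ∀ j, j < m → stepVec m j = 1 := fun j hj => by
    rw [stepVec, if_neg (by omega), if_pos hj]
  have hmid : stepVec m m = -(m : ℝ) := by simp [stepVec]; omega
  have hhigh : ∀ j, m < j → stepVec m j = 0 := fun j hj => by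
    rw [stepVec, if_neg (by omega), if_neg (by omega), if_neg (by omega)]
  rw [Pi.smul_apply, smul_eq_mul, hev]
  rcases lt_trichotomy (pos v) m with hv | hv | hv
  · have h1 : ∑ j ∈ Finset.range (pos v), (stepVec m (pos v) - stepVec m j) = 0 :=
      Finset.sum_eq_zero fun j hj => by
        rw [hlow _ hv, hlow j ((Finset.mem_range.1 hj).trans hv), sub_self]
    have h2 : ∑ j ∈ (Finset.range (N + 1)).filter (fun l => pos v < l ∧ s l = true),
        (stepVec m (pos v) - stepVec m j) = ∑ j ∈ Finset.range (N + 1),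
          ((if j = m then (if s m = true then (m : ℝ) + 1 else 0) else 0) +
            if m < j ∧ s j = true then 1 else 0) := by
      rw [Finset.sum_filter]
      refine Finset.sum_congr rfl fun j _ => ?_
      rcases lt_trichotomy j m with hj | rfl | hj
      · rw [hlow _ hv, hlow j hj, if_neg hj.ne,
          if_neg fun h : m < j ∧ s j = true => by omega]
        simp
      · rw [hlow _ hv, hmid, if_pos rfl, if_neg (by omega : ¬ (j < j ∧ s j = true))]
        by_cases hs : s j = true
        · simp [hs, hv, add_comm]
        · simp [hs]
      · rw [hlow _ hv, hhigh j hj, if_neg hj.ne']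
        by_cases hs : s j = true
        · simp [hs, hj, hv.trans hj]
        · simp [hs]
    rw [h1, h2, Finset.sum_add_distrib, Finset.sum_ite_eq', if_pos (Finset.mem_range.2 (by omega)),
      ← Finset.sum_filter, Finset.sum_const, card_join_filter s N m hm, hlow _ hv]
    simp
  · have h1 : ∑ j ∈ Finset.range m, (-(m : ℝ) - stepVec m j) = m * (-(m : ℝ) - 1) := by
      rw [Finset.sum_congr rfl (g := fun _ => -(m : ℝ) - 1) fun j hj => by
        rw [hlow j (Finset.mem_range.1 hj)], Finset.sum_const, Finset.card_range, nsmul_eq_mul]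
    have h2 : ∑ j ∈ (Finset.range (N + 1)).filter (fun l => m < l ∧ s l = true),
        (-(m : ℝ) - stepVec m j) = ((joinCount s N - joinCount s m : ℕ) : ℝ) * -(m : ℝ) := by
      rw [Finset.sum_congr rfl (g := fun _ => -(m : ℝ)) fun j hj => by
        rw [hhigh j (Finset.mem_filter.1 hj).2.1, sub_zero], Finset.sum_const,
        card_join_filter s N m hm, nsmul_eq_mul]
    rw [hv, hmid, h1, h2]
    split_ifs <;> ring
  · have h1 : ∑ j ∈ Finset.range (pos v), (stepVec m (pos v) - stepVec m j) = 0 := by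
      have := sum_stepVec_mul hm0 (fun _ => 1) hv
      simp only [mul_one, Finset.sum_const, Finset.card_range, nsmul_eq_mul, sub_self] at this
      rw [Finset.sum_sub_distrib, this, hhigh _ hv]
      simp
    rw [h1, hhigh _ hv, Finset.sum_eq_zero fun j hj => by
      rw [hhigh j (hv.trans (Finset.mem_filter.1 hj).2.1), sub_self]]
    simp

end IsCreation

/-! ### Diagonalization of the Laplacian -/

/-- The matrix whose rows are the Laplacian eigenvectors belonging to the steps. -/
def stepMatrix {V : Type*} (pos : V → ℕ) : Matrix V V ℝ :=
  Matrix.of fun v u => stepVec (pos v) (pos u)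

namespace IsCreation

variable {V : Type*} [Fintype V] {G : SimpleGraph V} {pos : V → ℕ} {s : ℕ → Bool} {N : ℕ}

theorem sum_extend (h : IsCreation G pos s N) (f : V → ℝ) :
    ∑ j ∈ Finset.range (N + 1), Function.extend pos f 0 j = ∑ v, f v := by
  rw [← h.sum_comp]
  exact Finset.sum_congr rfl fun v _ => h.extend_apply f v

theorem stepMatrix_mulVec (h : IsCreation G pos s N) (f : V → ℝ) (v : V) :
    (stepMatrix pos *ᵥ f) v
      = ∑ j ∈ Finset.range (N + 1), stepVec (pos v) j * Function.extend pos f 0 j := by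
  rw [← h.sum_comp]
  refine Finset.sum_congr rfl fun u _ => ?_
  rw [h.extend_apply]
  rfl

theorem stepMatrix_mulVec_of_pos (h : IsCreation G pos s N) (f : V → ℝ) (v : V)
    (hv : 1 ≤ pos v) : (stepMatrix pos *ᵥ f) v
      = ∑ j ∈ Finset.range (pos v), Function.extend pos f 0 j
        - pos v * Function.extend pos f 0 (pos v) := by
  rw [h.stepMatrix_mulVec, sum_stepVec_mul hv _ (Nat.lt_succ_of_le (h.le v))]

theorem stepMatrix_mulVec_of_zero (h : IsCreation G pos s N) (f : V → ℝ) (v : V)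
    (hv : pos v = 0) : (stepMatrix pos *ᵥ f) v = ∑ u, f u := by
  rw [h.stepMatrix_mulVec, ← h.sum_extend]
  simp [hv, stepVec]

variable [DecidableEq V]

/-- A kernel vector has sum zero and satisfies the mean relation at every step `≥ 1`, hence
vanishes. -/
theorem isUnit_stepMatrix (h : IsCreation G pos s N) : IsUnit (stepMatrix pos) := by
  rw [← Matrix.mulVec_injective_iff_isUnit]
  have key : ∀ f, stepMatrix pos *ᵥ f = 0 → f = 0 := by
    intro f hf
    obtain ⟨r, hr⟩ := h.surj 0 (Nat.zero_le _)
    have h0 : ∑ j ∈ Finset.range (N + 1), Function.extend pos f 0 j = 0 := by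
      rw [h.sum_extend, ← h.stepMatrix_mulVec_of_zero f r hr, hf]
      rfl
    have h1 : ∀ m, 1 ≤ m → m ≤ N → ∑ j ∈ Finset.range m, Function.extend pos f 0 j
        = m * Function.extend pos f 0 m := by
      intro m hm hmN
      obtain ⟨v, rfl⟩ := h.surj m hmN
      have := h.stepMatrix_mulVec_of_pos f v hm
      rw [hf] at this
      exact (sub_eq_zero.1 this.symm)
    have h2 := eq_zero_of_sum_range_eq_mul h0 h1
    have h3 : Function.extend pos f 0 0 = 0 := by
      rw [Finset.sum_range_succ', Finset.sum_eq_zero, zero_add] at h0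
      · exact h0
      · intro j hj
        exact h2 _ (by omega) (Finset.mem_range.1 hj)
    ext v
    rw [← h.extend_apply f v]
    rcases Nat.eq_zero_or_pos (pos v) with hv | hv
    · rw [hv, h3]; rfl
    · exact h2 _ hv (h.le v)
  intro x y hxy
  refine sub_eq_zero.1 (key _ ?_)
  rw [mulVec_sub, sub_eq_zero]
  exact hxy

variable [DecidableRel G.Adj]

theorem stepMatrix_mul_lapMatrix (h : IsCreation G pos s N) :
    stepMatrix pos * G.lapMatrix ℝ
      = diagonal (fun v => (stepEigenvalue s N (pos v) : ℝ)) * stepMatrix pos := by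
  ext v u
  rw [diagonal_mul]
  have := congrFun (h.lapMatrix_mulVec_stepVec (h.le v)) u
  rw [← Matrix.vecMul_transpose, (G.isSymm_lapMatrix (R := ℝ)).eq] at this
  exact this

theorem stepMatrix_mulVec_eq_zero (h : IsCreation G pos s N) {f : V → ℝ} {μ : ℝ}
    (hf : G.lapMatrix ℝ *ᵥ f = μ • f) (v : V) (hv : (stepEigenvalue s N (pos v) : ℝ) ≠ μ) :
    (stepMatrix pos *ᵥ f) v = 0 := by
  have h1 := congrArg (fun M => (M *ᵥ f) v) h.stepMatrix_mul_lapMatrix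
  simp only [← mulVec_mulVec, hf, mulVec_smul, mulVec_diagonal, Pi.smul_apply, smul_eq_mul] at h1
  exact (mul_eq_zero.1 (sub_eq_zero.2 h1 ▸ sub_mul _ _ _)).resolve_left (sub_ne_zero.2 hv.symm)

theorem lapEigenMult_eq (h : IsCreation G pos s N) (μ : ℝ) :
    lapEigenMult G μ
      = ((Finset.range (N + 1)).filter fun j => (stepEigenvalue s N j : ℝ) = μ).card := by
  have hdet : IsUnit (stepMatrix pos).det :=
    (Matrix.isUnit_iff_isUnit_det _).1 h.isUnit_stepMatrix
  set d : V → ℝ := fun v => (stepEigenvalue s N (pos v) : ℝ) - μ with hd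
  have h1 : stepMatrix pos * (G.lapMatrix ℝ - scalar V μ) = diagonal d * stepMatrix pos := by
    rw [mul_sub, h.stepMatrix_mul_lapMatrix, ← (scalar_commute μ (Commute.all μ) _).eq,
      ← sub_mul, scalar_apply, diagonal_sub]
  have h2 : (G.lapMatrix ℝ - scalar V μ).rank = Fintype.card {v // d v ≠ 0} := by
    rw [← rank_diagonal d, ← rank_mul_eq_left_of_isUnit_det _ (diagonal d) hdet, ← h1,
      rank_mul_eq_right_of_isUnit_det _ _ hdet]
  have h3 : Module.End.eigenspace (toLin' (G.lapMatrix ℝ)) μ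
      = LinearMap.ker (G.lapMatrix ℝ - scalar V μ).mulVecLin := by
    ext f
    rw [Module.End.mem_eigenspace_iff, LinearMap.mem_ker, mulVecLin_apply, sub_mulVec,
      sub_eq_zero, toLin'_apply, scalar_apply, ← smul_one_eq_diagonal, smul_mulVec, one_mulVec]
  have h4 := LinearMap.finrank_range_add_finrank_ker (G.lapMatrix ℝ - scalar V μ).mulVecLin
  rw [← h3, Module.finrank_fintype_fun_eq_card] at h4
  have h5 : (G.lapMatrix ℝ - scalar V μ).rank + lapEigenMult G μ = Fintype.card V := h4
  rw [h2, Fintype.card_subtype, ← Finset.card_univ,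
    ← Finset.card_filter_add_card_filter_not (s := Finset.univ) (fun v => d v ≠ 0)] at h5
  rw [← h.card_filter_comp, Nat.add_left_cancel h5]
  simp [hd, sub_eq_zero]

end IsCreation

/-! ### The shape of eigenvectors and their vanishing -/

section Sequence

variable {s : ℕ → Bool} {N : ℕ}

theorem stepEigenvalue_eq_of_between {i l j : ℕ} (h1 : 1 ≤ i) (hil : i ≤ l) (hlj : l ≤ j)
    (hj : j ≤ N) (h : stepEigenvalue s N i = stepEigenvalue s N j) :
    stepEigenvalue s N l = stepEigenvalue s N j := by
  induction j, hlj using Nat.le_induction with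
  | base => rfl
  | succ j hlj ih =>
    have key := stepEigenvalue_eq_succ h1 (hil.trans hlj) hj h
    rw [← key] at h ⊢
    exact ih (by omega) h

/-- An earlier step has the same degree. -/
def IsRepeated (s : ℕ → Bool) (N j : ℕ) : Prop := ∃ i < j, stepDegree s N i = stepDegree s N j

instance : DecidablePred (IsRepeated s N) := fun j => by
  unfold IsRepeated
  infer_instance

/-- The number of earlier steps with the same eigenvalue. -/
def stepOffset (s : ℕ → Bool) (N j : ℕ) : ℕ :=
  ((Finset.Ico 1 j).filter fun i => stepEigenvalue s N i = stepEigenvalue s N j).card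

theorem IsRepeated.pos {j : ℕ} (h : IsRepeated s N j) : 1 ≤ j := by
  obtain ⟨i, hi, -⟩ := h
  omega

theorem isRepeated_one (hN : 1 ≤ N) : IsRepeated s N 1 := ⟨0, one_pos, stepDegree_zero_eq_one hN⟩

theorem isRepeated_of_stepEigenvalue_eq {i j : ℕ} (h1 : 1 ≤ i) (hij : i < j) (hj : j ≤ N)
    (h : stepEigenvalue s N i = stepEigenvalue s N j) : IsRepeated s N j := by
  obtain ⟨k, rfl⟩ : ∃ k, j = k + 1 := ⟨j - 1, by omega⟩
  exact ⟨k, k.lt_succ_self, stepDegree_eq_of_stepEigenvalue_eq (by omega) hj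
    (stepEigenvalue_eq_succ h1 (by omega) hj h)⟩

theorem IsRepeated.stepEigenvalue_eq {k : ℕ} (h : IsRepeated s N (k + 1)) (hk : 1 ≤ k)
    (hN : k + 1 ≤ N) : stepEigenvalue s N k = stepEigenvalue s N (k + 1) := by
  obtain ⟨i, hi, h⟩ := h
  exact stepEigenvalue_eq_of_stepDegree_eq (Nat.lt_succ_iff.1 hi) hk hN h

/-- Beyond step `1`, a repeated step shares its eigenvalue with its predecessor. Step `1` is the
only first step of a run that is repeated, by way of step `0`. -/
theorem IsRepeated.eq_one_of_stepOffset_eq_zero {j : ℕ} (h : IsRepeated s N j) (hj : j ≤ N)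
    (h0 : stepOffset s N j = 0) : j = 1 := by
  have := h.pos
  obtain ⟨k, rfl⟩ : ∃ k, j = k + 1 := ⟨j - 1, by omega⟩
  by_contra hk
  have hmem : k ∈ (Finset.Ico 1 (k + 1)).filter fun i =>
      stepEigenvalue s N i = stepEigenvalue s N (k + 1) :=
    Finset.mem_filter.2 ⟨Finset.mem_Ico.2 ⟨by omega, by omega⟩,
      h.stepEigenvalue_eq (by omega) hj⟩
  rw [Finset.card_eq_zero.1 h0] at hmem
  exact Finset.notMem_empty _ hmem

theorem stepOffset_lt {i j : ℕ} (h1 : 1 ≤ i) (hij : i < j)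
    (h : stepEigenvalue s N i = stepEigenvalue s N j) : stepOffset s N i < stepOffset s N j := by
  apply Finset.card_lt_card
  rw [Finset.ssubset_iff_of_subset]
  · exact ⟨i, by simp [h1, hij, h], by simp⟩
  · intro l hl
    simp only [Finset.mem_filter, Finset.mem_Ico] at hl ⊢
    exact ⟨⟨hl.1.1, hl.1.2.trans hij⟩, hl.2.trans h⟩

theorem stepOffset_lt_card {j : ℕ} (hj : j ≤ N) :
    stepOffset s N j < ((Finset.range (N + 1)).filter fun i =>
      stepEigenvalue s N i = stepEigenvalue s N j).card := by
  apply Finset.card_lt_card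
  rw [Finset.ssubset_iff_of_subset]
  · exact ⟨j, by simp; omega, by simp⟩
  · intro l hl
    simp only [Finset.mem_filter, Finset.mem_Ico, Finset.mem_range] at hl ⊢
    exact ⟨by omega, hl.2⟩

/-- The shape of a Laplacian eigenvector: it is constant before the first step `a` with the given
eigenvalue and vanishes after the last one. -/
theorem exists_shape {g : ℕ → ℝ} {μ : ℝ}
    (hF : ∀ m, 1 ≤ m → m ≤ N → (stepEigenvalue s N m : ℝ) ≠ μ →
      ∑ j ∈ Finset.range m, g j = m * g m)
    (h0 : ∀ m, 1 ≤ m → m ≤ N → (stepEigenvalue s N m : ℝ) = μ →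
      ∑ j ∈ Finset.range (N + 1), g j = 0) :
    ∃ a, 1 ≤ a ∧ a ≤ N + 1 ∧ (∀ j < a, g j = g 0) ∧
      (∀ j, 1 ≤ j → j < a → (stepEigenvalue s N j : ℝ) ≠ μ) ∧
      (∀ j, a < j → j ≤ N → (stepEigenvalue s N j : ℝ) ≠ μ → g j = 0) ∧
      (a ≤ N → (stepEigenvalue s N a : ℝ) = μ ∧ ∑ j ∈ Finset.range (N + 1), g j = 0) := by
  classical
  by_cases hM : ∃ m, 1 ≤ m ∧ m ≤ N ∧ (stepEigenvalue s N m : ℝ) = μ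
  · obtain ⟨ha1, haN, haμ⟩ := Nat.find_spec hM
    have hmin : ∀ j, 1 ≤ j → j < Nat.find hM → (stepEigenvalue s N j : ℝ) ≠ μ :=
      fun j hj1 hja hj => Nat.find_min hM hja ⟨hj1, by omega, hj⟩
    refine ⟨Nat.find hM, ha1, by omega, ?_, hmin, ?_, fun _ => ⟨haμ, h0 _ ha1 haN haμ⟩⟩
    · exact eq_of_sum_range_eq_mul fun m hm hma => hF m hm (by omega) (hmin m hm hma)
    · intro j haj hjN hjμ
      -- The steps with eigenvalue `μ` form an interval containing `a`, so none occurs from `j` on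
      -- and the mean relations hold up to `N`.
      refine eq_zero_of_sum_range_eq_mul (h0 _ ha1 haN haμ) (b := j) (fun m hjm hmN => ?_) j le_rfl
        hjN
      refine hF m (by omega) hmN fun hmμ => hjμ ?_
      have := stepEigenvalue_eq_of_between ha1 haj.le hjm hmN
        (by exact_mod_cast haμ.trans hmμ.symm)
      rw [this, hmμ]
  · push Not at hM
    exact ⟨N + 1, by omega, le_rfl,
      eq_of_sum_range_eq_mul fun m hm hma => hF m hm (by omega) (hM m hm (by omega)),
      fun j hj1 hj => hM j hj1 (by omega), fun j h1 h2 => by omega, fun h => by omega⟩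

/-- A Laplacian eigenvector that vanishes at all repeated steps is zero. -/
theorem eq_zero_of_isRepeated {g : ℕ → ℝ} {μ : ℝ} (hN : 1 ≤ N)
    (hF : ∀ m, 1 ≤ m → m ≤ N → (stepEigenvalue s N m : ℝ) ≠ μ →
      ∑ j ∈ Finset.range m, g j = m * g m)
    (h0 : ∀ m, 1 ≤ m → m ≤ N → (stepEigenvalue s N m : ℝ) = μ →
      ∑ j ∈ Finset.range (N + 1), g j = 0)
    (hz : ∀ j ≤ N, IsRepeated s N j → g j = 0) (j : ℕ) (hj : j ≤ N) : g j = 0 := by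
  obtain ⟨a, ha1, haN, hconst, hmin, hhigh, ha⟩ := exists_shape hF h0
  have hg1 : g 1 = 0 := hz 1 hN (isRepeated_one hN)
  have hlow : 2 ≤ a → ∀ j < a, g j = 0 := fun h2 j hj => by
    rw [hconst j hj, ← hconst 1 (by omega), hg1]
  have hup : ∀ j, a < j → j ≤ N → g j = 0 := fun j haj hjN => by
    by_cases hjμ : (stepEigenvalue s N j : ℝ) = μ
    · refine hz j hjN (isRepeated_of_stepEigenvalue_eq ha1 haj hjN ?_)
      exact_mod_cast (ha (by omega)).1.trans hjμ.symm
    · exact hhigh j haj hjN hjμ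
  by_cases haN' : a ≤ N
  · have hsum := (ha haN').2
    -- At most one entry `c` survives, and the zero sum kills it: `c = 0` if the run starts at step
    -- `1`, and `c = a` otherwise.
    have hall : ∀ c ≤ N, (∀ j ≤ N, j ≠ c → g j = 0) → g j = 0 := fun c hc hc0 => by
      rw [Finset.sum_eq_single c (fun j hj hjc => hc0 j (Nat.lt_succ_iff.1 (Finset.mem_range.1 hj))
        hjc) fun h => absurd (Finset.mem_range.2 (by omega)) h] at hsum
      by_cases hjc : j = c
      · rw [hjc, hsum]
      · exact hc0 j hj hjc
    rcases ha1.eq_or_lt with rfl | ha2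
    · refine hall 0 (by omega) fun i hi hi0 => ?_
      rcases (show 1 ≤ i by omega).eq_or_lt with rfl | hi1
      · exact hg1
      · exact hup i hi1 hi
    · refine hall a haN' fun i hi hia => ?_
      rcases lt_or_gt_of_ne hia with h | h
      · exact hlow ha2 i h
      · exact hup i h hi
  · exact hlow (by omega) j (by omega)

/-- If the sums of a Laplacian eigenvector over the repeated steps of any given offset vanish, then
it vanishes at all repeated steps. -/
theorem eq_zero_of_sum_stepOffset_eq_zero {g : ℕ → ℝ} {μ : ℝ} (hN : 1 ≤ N)
    (hF : ∀ m, 1 ≤ m → m ≤ N → (stepEigenvalue s N m : ℝ) ≠ μ →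
      ∑ j ∈ Finset.range m, g j = m * g m)
    (h0 : ∀ m, 1 ≤ m → m ≤ N → (stepEigenvalue s N m : ℝ) = μ →
      ∑ j ∈ Finset.range (N + 1), g j = 0)
    (hcol : ∀ i ≤ N, ∑ j ∈ (Finset.range (N + 1)).filter (fun j => IsRepeated s N j ∧
      stepOffset s N j = stepOffset s N i), g j = 0) (j : ℕ) (hj : j ≤ N)
    (hr : IsRepeated s N j) : g j = 0 := by
  obtain ⟨a, ha1, haN, hconst, hmin, hhigh, ha⟩ := exists_shape hF h0
  have hcol' : ∀ i ≤ N, IsRepeated s N i → (∀ j ≤ N, IsRepeated s N j →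
      stepOffset s N j = stepOffset s N i → j ≠ i → g j = 0) → g i = 0 := fun i hi hri h => by
    rw [← hcol i hi]
    refine (Finset.sum_eq_single_of_mem i ?_ fun j hj hji => ?_).symm
    · simp only [Finset.mem_filter, Finset.mem_range, hri, and_true]
      omega
    · simp only [Finset.mem_filter, Finset.mem_range] at hj
      exact h j (by omega) hj.2.1 hj.2.2 hji
  -- The column of offset `0` contains step `1` only.
  have hg1 : g 1 = 0 := by
    refine hcol' 1 hN (isRepeated_one hN) fun j hj hrj hoff hj1 => absurd ?_ hj1
    exact hrj.eq_one_of_stepOffset_eq_zero hj (by rw [hoff]; simp [stepOffset])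
  have hlow : ∀ j < a, IsRepeated s N j → g j = 0 := fun j hj hrj => by
    have := hrj.pos
    rw [hconst j hj, ← hconst 1 (by omega), hg1]
  have hmid : IsRepeated s N a → a ≤ N → g a = 0 := fun hra haN' => by
    rcases ha1.eq_or_lt with rfl | ha2
    · exact hg1
    obtain ⟨k, rfl⟩ : ∃ k, a = k + 1 := ⟨a - 1, by omega⟩
    refine absurd ?_ (hmin k (by omega) k.lt_succ_self)
    rw [hra.stepEigenvalue_eq (by omega) haN', (ha haN').1]
  rcases lt_trichotomy j a with h | rfl | h
  · exact hlow j h hr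
  · exact hmid hr hj
  by_cases hjμ : (stepEigenvalue s N j : ℝ) = μ
  -- Within the run offsets are distinct, and all other repeated steps already vanish, so each
  -- column sum has at most one nonzero term.
  · refine hcol' j hj hr fun i hi hri hoff hij => ?_
    rcases lt_trichotomy i a with h' | rfl | h'
    · exact hlow i h' hri
    · exact hmid hri hi
    by_cases hiμ : (stepEigenvalue s N i : ℝ) = μ
    · have hij' : stepEigenvalue s N i = stepEigenvalue s N j := by
        exact_mod_cast hiμ.trans hjμ.symm
      rcases lt_or_gt_of_ne hij with hlt | hlt
      · exact absurd hoff (stepOffset_lt (by omega) hlt hij').ne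
      · exact absurd hoff (stepOffset_lt (by omega) hlt hij'.symm).ne'
    · exact hhigh i h' hi hiμ
  · exact hhigh j h hj hjμ

end Sequence

/-! ### Necessary conditions: eigenspaces and degree classes -/

theorem LaplacianControllable.eq_zero {V κ : Type*} [Fintype V] [DecidableEq V] [Fintype κ]
    {G : SimpleGraph V} [DecidableRel G.Adj] {B : Matrix V κ ℝ} (h : LaplacianControllable G B)
    {f : V → ℝ} {μ : ℝ} (hf : G.lapMatrix ℝ *ᵥ f = μ • f) (hB : f ᵥ* B = 0) : f = 0 := by
  refine IsControllable.eq_zero_of_vecMul_eq_zero (μ := -μ) h ?_ hB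
  rw [vecMul_neg, neg_smul, ← hf, ← vecMul_transpose, (G.isSymm_lapMatrix (R := ℝ)).eq]

/-- An eigenspace is at most as large as the number of inputs. -/
theorem LaplacianControllable.lapEigenMult_le {V κ : Type*} [Fintype V] [DecidableEq V]
    [Fintype κ] {G : SimpleGraph V} [DecidableRel G.Adj] {B : Matrix V κ ℝ}
    (h : LaplacianControllable G B) (μ : ℝ) : lapEigenMult G μ ≤ Fintype.card κ := by
  rw [← Module.finrank_fintype_fun_eq_card (R := ℝ) (η := κ)]
  refine LinearMap.finrank_le_finrank_of_injective
    (f := Bᵀ.mulVecLin.domRestrict (Module.End.eigenspace (toLin' (G.lapMatrix ℝ)) μ)) ?_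
  rw [← LinearMap.ker_eq_bot, LinearMap.ker_eq_bot']
  rintro ⟨f, hf⟩ hBf
  rw [Module.End.mem_eigenspace_iff, toLin'_apply] at hf
  rw [LinearMap.domRestrict_apply, mulVecLin_apply, mulVec_transpose] at hBf
  exact Subtype.ext (h.eq_zero hf hBf)

namespace IsCreation

variable {V : Type*} {G : SimpleGraph V} {pos : V → ℕ} {s : ℕ → Bool} {N : ℕ}

theorem adj_iff_max (h : IsCreation G pos s N) {u v : V} (huv : u ≠ v) :
    G.Adj u v ↔ s (max (pos u) (pos v)) = true := by
  rcases lt_or_gt_of_ne (h.inj.ne huv) with hlt | hlt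
  · rw [h.adj u v hlt, max_eq_right hlt.le]
  · rw [G.adj_comm, h.adj v u hlt, max_eq_left hlt.le]

variable [Fintype V]

theorem card_eq (h : IsCreation G pos s N) : Fintype.card V = N + 1 := by
  rw [← Finset.card_univ, ← Finset.card_image_of_injective _ h.inj, h.image_pos,
    Finset.card_range]

variable [DecidableRel G.Adj]

theorem conjDegree_conjIndex (h : IsCreation G pos s N) {j : ℕ} (hj : j ≤ N) :
    conjDegree G (conjIndex s N j) = stepEigenvalue s N j := by
  rw [← card_conjIndex_le_stepDegree hj, ← h.card_filter_comp, conjDegree]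
  simp_rw [h.degree_eq]

/-- Distinct vertices of a common degree are all adjacent or all non-adjacent. -/
theorem adj_iff_adj_of_degree_eq (h : IsCreation G pos s N) {u v u' v' : V} (huv : u ≠ v)
    (huv' : u' ≠ v') (h1 : G.degree v = G.degree u) (h2 : G.degree u' = G.degree u)
    (h3 : G.degree v' = G.degree u) : G.Adj u v ↔ G.Adj u' v' := by
  -- The later vertex of a pair decides adjacency; it is not step `0`, so its type is the common
  -- type of the class.
  have hmax : ∀ x y : V, x ≠ y → G.degree x = G.degree u → G.degree y = G.degree u →
      ∃ w, pos w = max (pos x) (pos y) ∧ 1 ≤ pos w ∧ G.degree w = G.degree u := by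
    intro x y hxy hx hy
    rcases lt_or_gt_of_ne (h.inj.ne hxy) with hlt | hlt
    · exact ⟨y, (max_eq_right hlt.le).symm, by omega, hy⟩
    · exact ⟨x, (max_eq_left hlt.le).symm, by omega, hx⟩
  obtain ⟨w, hw, hw1, hwd⟩ := hmax u v huv rfl h1
  obtain ⟨w', hw', hw1', hwd'⟩ := hmax u' v' huv' h2 h3
  rw [h.adj_iff_max huv, h.adj_iff_max huv', ← hw, ← hw']
  rw [h.degree_eq w, ← hwd', h.degree_eq w'] at hwd
  rcases le_total (pos w) (pos w') with hle | hle
  · rw [step_eq_of_stepDegree_eq hw1 hle (h.le w') hwd]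
  · rw [step_eq_of_stepDegree_eq hw1' hle (h.le w) hwd.symm]

/-- Vertices of the same degree have the same further neighbours. -/
theorem adj_iff_of_degree_eq (h : IsCreation G pos s N) {u u' v : V} (hu : v ≠ u) (hu' : v ≠ u')
    (hd : G.degree u = G.degree u') : G.Adj v u ↔ G.Adj v u' := by
  wlog hlt : pos u < pos u' generalizing u u'
  · rcases (not_lt.1 hlt).eq_or_lt with heq | hlt'
    · rw [h.inj heq]
    · exact (this hu' hu hd.symm hlt').symm
  rw [h.adj_iff_max hu, h.adj_iff_max hu']
  rw [h.degree_eq, h.degree_eq] at hd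
  rcases lt_or_gt_of_ne (h.inj.ne hu) with h1 | h1
  · rw [max_eq_right h1.le, max_eq_right (h1.trans hlt).le,
      step_eq_of_stepDegree_eq (by omega) hlt.le (h.le u') hd]
  rw [max_eq_left h1.le]
  rcases lt_or_gt_of_ne (h.inj.ne hu') with h2 | h2
  · rw [max_eq_right h2.le, step_eq_of_stepDegree_eq (by omega) h2.le (h.le u')
      (stepDegree_eq_of_between h1.le h2.le (h.le u') hd)]
  · rw [max_eq_left h2.le]

variable [DecidableEq V]

/-- A vector with zero sum supported on the vertices of a given degree is a Laplacian
eigenvector. -/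
theorem exists_lapMatrix_mulVec_eq_smul (h : IsCreation G pos s N) {f : V → ℝ} {d : ℕ}
    (hd : ∀ v, G.degree v ≠ d → f v = 0) (hsum : ∑ v, f v = 0) :
    ∃ μ : ℝ, G.lapMatrix ℝ *ᵥ f = μ • f := by
  classical
  -- A vertex sees all other members of the class or none, so by the zero sum its neighbours
  -- contribute `-f v` or `0`.
  have hN : ∀ v, ∑ u ∈ G.neighborFinset v, f u
      = if ∃ u, u ≠ v ∧ G.degree u = d ∧ G.Adj v u then -f v else 0 := by
    intro v
    have h1 : ∑ u ∈ G.neighborFinset v, f u = ∑ u, if G.Adj v u then f u else 0 := by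
      rw [← Finset.sum_filter]
      exact Finset.sum_congr (by ext; simp) fun _ _ => rfl
    rw [h1]
    split_ifs with hex
    · obtain ⟨w, hwv, hwd, hw⟩ := hex
      have e1 := Finset.add_sum_erase Finset.univ f (Finset.mem_univ v)
      have e2 := Finset.add_sum_erase Finset.univ (fun u => if G.Adj v u then f u else 0)
        (Finset.mem_univ v)
      have e3 : ∑ u ∈ Finset.univ.erase v, (if G.Adj v u then f u else 0)
          = ∑ u ∈ Finset.univ.erase v, f u := by
        refine Finset.sum_congr rfl fun u hu => ?_
        by_cases hud : G.degree u = d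
        · rw [if_pos ((h.adj_iff_of_degree_eq hwv.symm (Finset.ne_of_mem_erase hu).symm
            (hwd.trans hud.symm)).1 hw)]
        · rw [hd u hud, ite_self]
      simp only [G.irrefl, if_false, zero_add] at e2
      rw [← e2, e3]
      linarith
    · refine Finset.sum_eq_zero fun u _ => ?_
      split_ifs with hu
      · by_contra hfu
        exact hex ⟨u, hu.ne', by_contra fun hud => hfu (hd u hud), hu⟩
      · rfl
  -- The eigenvalue is `d + 1` if the class is a clique with at least two vertices, and `d` if it is
  -- independent.
  refine ⟨d + if ∃ x y, x ≠ y ∧ G.degree x = d ∧ G.degree y = d ∧ G.Adj x y then 1 else 0, ?_⟩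
  ext v
  rw [SimpleGraph.lapMatrix_mulVec_apply, hN, Pi.smul_apply, smul_eq_mul]
  by_cases hv : G.degree v = d
  · have : (∃ x y, x ≠ y ∧ G.degree x = d ∧ G.degree y = d ∧ G.Adj x y) ↔
        ∃ u, u ≠ v ∧ G.degree u = d ∧ G.Adj v u := by
      constructor
      · rintro ⟨x, y, hxy, hx, hy, hadj⟩
        obtain ⟨u, hu, huv⟩ : ∃ u, G.degree u = d ∧ u ≠ v := by
          by_cases hxv : x = v
          · exact ⟨y, hy, fun hyv => hxy (hxv.trans hyv.symm)⟩
          · exact ⟨x, hx, hxv⟩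
        exact ⟨u, huv, hu, (h.adj_iff_adj_of_degree_eq hxy huv.symm (hy.trans hx.symm)
          (hv.trans hx.symm) (hu.trans hx.symm)).1 hadj⟩
      · rintro ⟨u, huv, hu, hadj⟩
        exact ⟨v, u, huv.symm, hv, hu, hadj⟩
    simp only [this, hv]
    split_ifs <;> ring
  · rw [hd v hv]
    simp

/-- The rank bound for the blocks of a controllable control matrix. -/
theorem le_rank_degreeBlock (h : IsCreation G pos s N) {κ : Type*} [Fintype κ]
    {B : Matrix V κ ℝ} (hB : LaplacianControllable G B) (d : ℕ) :
    degreeMult G d - 1 ≤ (degreeBlock G B d).rank := by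
  set M := degreeBlock G B d with hM
  have h1 := LinearMap.finrank_range_add_finrank_ker Mᵀ.mulVecLin
  rw [Module.finrank_fintype_fun_eq_card] at h1
  have h2 : M.rank + Module.finrank ℝ (LinearMap.ker Mᵀ.mulVecLin) = degreeMult G d := by
    rw [← rank_transpose]
    exact h1
  -- The coordinate sum is injective on this kernel: a zero-sum element, extended by zero, is an
  -- eigenvector annihilated by `B`.
  have h3 : Module.finrank ℝ (LinearMap.ker Mᵀ.mulVecLin) ≤ 1 := by
    rw [← Module.finrank_self ℝ]
    refine LinearMap.finrank_le_finrank_of_injective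
      (f := (∑ i, LinearMap.proj i : ({v : V // G.degree v = d} → ℝ) →ₗ[ℝ] ℝ).domRestrict _) ?_
    rw [← LinearMap.ker_eq_bot, LinearMap.ker_eq_bot']
    rintro ⟨x, hx⟩ hsum
    rw [LinearMap.mem_ker, mulVecLin_apply, mulVec_transpose] at hx
    have hsum' : ∑ i, x i = 0 := by simpa using hsum
    set f : V → ℝ := fun v => if hv : G.degree v = d then x ⟨v, hv⟩ else 0 with hf
    have hext : ∀ c : V → ℝ, ∑ v, f v * c v = ∑ i, x i * c i := by
      intro c
      have e1 : ∑ v ∈ Finset.univ.filter (fun v => G.degree v = d), f v * c v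
          = ∑ v, f v * c v := by
        refine Finset.sum_filter_of_ne fun v _ hv => ?_
        by_contra hvd
        simp [hf, hvd] at hv
      rw [← e1, Finset.sum_subtype _ (p := fun v => G.degree v = d) (by simp)]
      refine Finset.sum_congr rfl fun i _ => ?_
      simp [hf, i.2]
    have hf0 : ∑ v, f v = 0 := by
      have := hext fun _ => 1
      simp only [mul_one] at this
      rw [this, hsum']
    obtain ⟨μ, hμ⟩ := h.exists_lapMatrix_mulVec_eq_smul (f := f) (d := d)
      (fun v hv => dif_neg hv) hf0
    have hfB : f ᵥ* B = 0 := by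
      ext l
      exact (hext fun v => B v l).trans (congrFun hx l)
    have hz := hB.eq_zero hμ hfB
    refine Subtype.ext (funext fun i => ?_)
    have := congrFun hz i
    simpa [hf, i.2] using this
  omega

/-- The eigenvector test for controllability of threshold graphs. -/
theorem laplacianControllable_of_forall (h : IsCreation G pos s N) {κ : Type*} [Fintype κ]
    {B : Matrix V κ ℝ}
    (hB : ∀ (f : V → ℝ) (μ : ℝ), G.lapMatrix ℝ *ᵥ f = μ • f → f ᵥ* B = 0 → f = 0) :
    LaplacianControllable G B := by
  refine isControllable_of_diagonalization (stepMatrix pos)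
    (fun v => -(stepEigenvalue s N (pos v) : ℝ)) h.isUnit_stepMatrix ?_ fun f m hf hfB => ?_
  · rw [mul_neg, h.stepMatrix_mul_lapMatrix, ← neg_mul, diagonal_neg]
  · refine hB f (-m) ?_ hfB
    rw [vecMul_neg, neg_eq_iff_eq_neg, ← neg_smul] at hf
    rw [← hf, ← mulVec_transpose, (G.isSymm_lapMatrix (R := ℝ)).eq]

end IsCreation

/-! ### Multiplicities and optimal control matrices -/

theorem injOn_conjIndex {s : ℕ → Bool} {N : ℕ} :
    Set.InjOn (conjIndex s N) (Finset.range (N + 1)) := by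
  intro i hi j hj hij
  simp only [Finset.coe_range, Set.mem_Iio] at hi hj
  by_contra hne
  rcases lt_or_gt_of_ne hne with hlt | hlt
  · exact conjIndex_ne hlt (by omega) hij
  · exact conjIndex_ne hlt (by omega) hij.symm

theorem image_conjIndex {s : ℕ → Bool} {N : ℕ} :
    (Finset.range (N + 1)).image (conjIndex s N) = Finset.Icc 1 (N + 1) := by
  refine Finset.eq_of_subset_of_card_le ?_ ?_
  · intro i hi
    obtain ⟨j, hj, rfl⟩ := Finset.mem_image.1 hi
    exact conjIndex_mem (Nat.lt_succ_iff.1 (Finset.mem_range.1 hj))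
  · rw [Finset.card_image_of_injOn injOn_conjIndex]
    simp

/-- The binary control matrix whose row at a repeated step is the unit vector given by the offset of
the step, and whose other rows vanish. -/
def offsetMatrix {V : Type*} (pos : V → ℕ) (s : ℕ → Bool) (N p : ℕ) : Matrix V (Fin p) ℝ :=
  Matrix.of fun v t => if IsRepeated s N (pos v) ∧ stepOffset s N (pos v) = t then 1 else 0

theorem isBinary_offsetMatrix {V : Type*} (pos : V → ℕ) (s : ℕ → Bool) (N p : ℕ) :
    IsBinary (offsetMatrix pos s N p) := by
  intro v t h
  simp only [offsetMatrix, of_apply] at h ⊢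
  split_ifs at h ⊢
  · rfl
  · exact absurd rfl h

namespace IsCreation

variable {V : Type*} [Fintype V] {G : SimpleGraph V} {pos : V → ℕ} {s : ℕ → Bool} {N : ℕ}
  [DecidableRel G.Adj]

theorem conjMult_eq (h : IsCreation G pos s N) (c : ℕ) :
    conjMult G c = ((Finset.range (N + 1)).filter fun j => stepEigenvalue s N j = c).card := by
  rw [conjMult, h.card_eq, ← image_conjIndex (s := s), Finset.filter_image,
    Finset.card_image_of_injOn (injOn_conjIndex.mono (by
      exact_mod_cast Finset.filter_subset _ _))]
  congr 1
  refine Finset.filter_congr fun j hj => ?_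
  rw [h.conjDegree_conjIndex (Nat.lt_succ_iff.1 (Finset.mem_range.1 hj))]

theorem conjMult_le_maxConjMult (h : IsCreation G pos s N) {j : ℕ} (hj : j ≤ N) :
    conjMult G (stepEigenvalue s N j) ≤ maxConjMult G := by
  rw [← h.conjDegree_conjIndex hj, maxConjMult, h.card_eq]
  exact Finset.le_sup (f := fun i => conjMult G (conjDegree G i)) (conjIndex_mem hj)

theorem exists_maxConjMult_eq (h : IsCreation G pos s N) :
    ∃ j ≤ N, maxConjMult G = conjMult G (stepEigenvalue s N j) := by
  obtain ⟨i, hi, hsup⟩ := Finset.exists_mem_eq_sup (Finset.Icc 1 (Fintype.card V))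
    (by rw [h.card_eq]; simp) fun i => conjMult G (conjDegree G i)
  rw [h.card_eq, ← image_conjIndex (s := s)] at hi
  obtain ⟨j, hj, rfl⟩ := Finset.mem_image.1 hi
  have hj' := Nat.lt_succ_iff.1 (Finset.mem_range.1 hj)
  exact ⟨j, hj', by rw [maxConjMult, hsup, h.conjDegree_conjIndex hj']⟩

/-- Every degree class contains a vertex that is not a repeated step. -/
theorem exists_not_isRepeated (h : IsCreation G pos s N) {d : ℕ} (hd : d ∈ distinctDegrees G) :
    ∃ v, G.degree v = d ∧ ¬ IsRepeated s N (pos v) := by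
  obtain ⟨u, -, hu⟩ := Finset.mem_image.1 hd
  obtain ⟨v, hv, hmin⟩ := Finset.exists_min_image (Finset.univ.filter fun v => G.degree v = d) pos
    ⟨u, by simp [hu]⟩
  have hvd := (Finset.mem_filter.1 hv).2
  refine ⟨v, hvd, ?_⟩
  rintro ⟨i, hi, hiv⟩
  obtain ⟨w, rfl⟩ := h.surj i (hi.le.trans (h.le v))
  rw [← h.degree_eq, ← h.degree_eq, hvd] at hiv
  exact absurd (hmin w (by simp [hiv])) (not_le.2 hi)

theorem card_not_isRepeated (h : IsCreation G pos s N) :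
    (Finset.univ.filter fun v => ¬ IsRepeated s N (pos v)).card = (distinctDegrees G).card := by
  refine Finset.card_nbij (fun v => G.degree v)
    (fun v _ => Finset.mem_image_of_mem _ (Finset.mem_univ v)) ?_ ?_
  · intro u hu v hv huv
    simp only [Finset.coe_filter, Finset.mem_univ, true_and, Set.mem_ofPred_eq] at hu hv
    simp only [h.degree_eq] at huv
    by_contra hne
    rcases lt_or_gt_of_ne (h.inj.ne hne) with hlt | hlt
    · exact hv ⟨_, hlt, huv⟩
    · exact hu ⟨_, hlt, huv.symm⟩
  · intro d hd
    obtain ⟨v, hvd, hv⟩ := h.exists_not_isRepeated hd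
    exact ⟨v, by simpa using hv, hvd⟩

variable [DecidableEq V]

theorem lapEigenMult_eq_conjMult (h : IsCreation G pos s N) (c : ℕ) :
    lapEigenMult G (c : ℝ) = conjMult G c := by
  rw [h.lapEigenMult_eq, h.conjMult_eq]
  simp

theorem isGreatest_maxConjMult (h : IsCreation G pos s N) :
    IsGreatest {m : ℕ | ∃ μ : ℝ, Module.End.HasEigenvalue (toLin' (G.lapMatrix ℝ)) μ ∧
      lapEigenMult G μ = m} (maxConjMult G) := by
  constructor
  · obtain ⟨j, hj, hmax⟩ := h.exists_maxConjMult_eq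
    have heq := h.lapEigenMult_eq_conjMult (stepEigenvalue s N j)
    refine ⟨(stepEigenvalue s N j : ℝ), ?_, heq.trans hmax.symm⟩
    rw [Module.End.hasEigenvalue_iff]
    intro hbot
    rw [lapEigenMult, hbot, finrank_bot, h.conjMult_eq, eq_comm, Finset.card_eq_zero,
      Finset.filter_eq_empty_iff] at heq
    exact heq (Finset.mem_range.2 (Nat.lt_succ_of_le hj)) rfl
  · rintro m ⟨μ, hμ, rfl⟩
    have hpos : lapEigenMult G μ ≠ 0 := fun h0 =>
      (Module.End.hasEigenvalue_iff.1 hμ) (Submodule.finrank_eq_zero.1 h0)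
    have hpos' := hpos
    rw [h.lapEigenMult_eq, Finset.card_ne_zero] at hpos'
    obtain ⟨j, hj'⟩ := hpos'
    obtain ⟨hj, rfl⟩ := Finset.mem_filter.1 hj'
    rw [h.lapEigenMult_eq_conjMult]
    exact h.conjMult_le_maxConjMult (Nat.lt_succ_iff.1 (Finset.mem_range.1 hj))

theorem maxConjMult_le (h : IsCreation G pos s N) {κ : Type*} [Fintype κ] {B : Matrix V κ ℝ}
    (hB : LaplacianControllable G B) : maxConjMult G ≤ Fintype.card κ := by
  obtain ⟨j, -, hj⟩ := h.exists_maxConjMult_eq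
  rw [hj, ← h.lapEigenMult_eq_conjMult]
  exact hB.lapEigenMult_le _

/-- The eigenvector relations in terms of partial sums. -/
theorem sum_range_extend_eq (h : IsCreation G pos s N) {f : V → ℝ} {μ : ℝ}
    (hf : G.lapMatrix ℝ *ᵥ f = μ • f) (m : ℕ) (h1 : 1 ≤ m) (hm : m ≤ N)
    (hμ : (stepEigenvalue s N m : ℝ) ≠ μ) :
    ∑ j ∈ Finset.range m, Function.extend pos f 0 j = m * Function.extend pos f 0 m := by
  obtain ⟨v, rfl⟩ := h.surj m hm
  rw [← sub_eq_zero, ← h.stepMatrix_mulVec_of_pos f v h1, h.stepMatrix_mulVec_eq_zero hf v hμ]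

/-- Since `μ` is positive, `f` is orthogonal to the constant vector, which belongs to the eigenvalue
`0`. -/
theorem sum_range_extend_eq_zero (h : IsCreation G pos s N) (hlast : s N = true) {f : V → ℝ}
    {μ : ℝ} (hf : G.lapMatrix ℝ *ᵥ f = μ • f) (m : ℕ) (h1 : 1 ≤ m) (hm : m ≤ N)
    (hμ : (stepEigenvalue s N m : ℝ) = μ) :
    ∑ j ∈ Finset.range (N + 1), Function.extend pos f 0 j = 0 := by
  obtain ⟨r, hr⟩ := h.surj 0 (Nat.zero_le _)
  rw [h.sum_extend, ← h.stepMatrix_mulVec_of_zero f r hr]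
  refine h.stepMatrix_mulVec_eq_zero hf r ?_
  rw [hr, ← hμ]
  have := stepEigenvalue_pos hlast h1 hm
  simp only [stepEigenvalue, if_true]
  exact_mod_cast this.ne

theorem laplacianControllable_of_isRepeated (h : IsCreation G pos s N) (hN : 1 ≤ N)
    (hlast : s N = true) {κ : Type*} [Fintype κ] {B : Matrix V κ ℝ}
    (hB : ∀ f : V → ℝ, f ᵥ* B = 0 → ∀ v, IsRepeated s N (pos v) → f v = 0) :
    LaplacianControllable G B := by
  refine h.laplacianControllable_of_forall fun f μ hf hfB => ?_
  ext v
  rw [← h.extend_apply f v]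
  refine eq_zero_of_isRepeated hN (h.sum_range_extend_eq hf) (h.sum_range_extend_eq_zero hlast hf)
    (fun j hj hr => ?_) _ (h.le v)
  obtain ⟨u, rfl⟩ := h.surj j hj
  rw [h.extend_apply]
  exact hB f hfB u hr

theorem laplacianControllable_offsetMatrix (h : IsCreation G pos s N) (hN : 1 ≤ N)
    (hlast : s N = true) {p : ℕ} (hp : maxConjMult G ≤ p) :
    LaplacianControllable G (offsetMatrix pos s N p) := by
  refine h.laplacianControllable_of_forall fun f μ hf hfB => ?_
  have hF := h.sum_range_extend_eq hf
  have h0 := h.sum_range_extend_eq_zero hlast hf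
  ext v
  rw [← h.extend_apply f v]
  refine eq_zero_of_isRepeated hN hF h0
    (eq_zero_of_sum_stepOffset_eq_zero hN hF h0 fun i hi => ?_) _ (h.le v)
  -- An offset is smaller than the multiplicity of its eigenvalue, so each offset has its own
  -- column.
  have hoff : stepOffset s N i < p := by
    refine (stepOffset_lt_card hi).trans_le (le_trans ?_ hp)
    rw [← h.conjMult_eq]
    exact h.conjMult_le_maxConjMult hi
  refine Eq.trans ?_ (congrFun hfB ⟨_, hoff⟩)
  rw [Finset.sum_filter, ← h.sum_comp]
  refine Finset.sum_congr rfl fun u _ => ?_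
  simp [offsetMatrix, h.extend_apply]

theorem rank_degreeBlock_offsetMatrix (h : IsCreation G pos s N) (hN : 1 ≤ N)
    (hlast : s N = true) {p : ℕ} (hp : maxConjMult G ≤ p) {d : ℕ} (hd : d ∈ distinctDegrees G) :
    (degreeBlock G (offsetMatrix pos s N p) d).rank = degreeMult G d - 1 := by
  refine le_antisymm ?_
    (h.le_rank_degreeBlock (h.laplacianControllable_offsetMatrix hN hlast hp) d)
  obtain ⟨v, hvd, hv⟩ := h.exists_not_isRepeated hd
  refine Nat.le_sub_one_of_lt ?_
  rw [Matrix.rank, degreeMult, ← Module.finrank_fintype_fun_eq_card (R := ℝ)]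
  refine Submodule.finrank_lt fun htop => ?_
  -- The row of a non-repeated vertex is zero, so its unit vector is not in the range of the block.
  have hmem : (Pi.single ⟨v, hvd⟩ 1 : {v : V // G.degree v = d} → ℝ) ∈
      LinearMap.range (degreeBlock G (offsetMatrix pos s N p) d).mulVecLin := htop ▸ trivial
  obtain ⟨x, hx⟩ := hmem
  have := congrFun hx ⟨v, hvd⟩
  rw [mulVecLin_apply, Pi.single_eq_same] at this
  simp [degreeBlock, offsetMatrix, Matrix.mulVec, dotProduct, hv] at this

/-- One input at each repeated step, that is, at all vertices but the first of each degree class. -/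
theorem exists_isTerminal (h : IsCreation G pos s N) (hN : 1 ≤ N) (hlast : s N = true) :
    ∃ B : Matrix V (Fin (Fintype.card V - (distinctDegrees G).card)) ℝ,
      IsTerminal B ∧ LaplacianControllable G B := by
  have hcard : Fintype.card {v // IsRepeated s N (pos v)}
      = Fintype.card V - (distinctDegrees G).card := by
    rw [← h.card_not_isRepeated, Fintype.card_subtype, ← Finset.card_univ,
      ← Finset.card_filter_add_card_filter_not (s := Finset.univ)
        (fun v => IsRepeated s N (pos v)), Nat.add_sub_cancel]
  let e := Fintype.equivFinOfCardEq hcard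
  refine ⟨Matrix.of fun v t => if v = e.symm t then 1 else 0, fun t => ⟨e.symm t, by simp, ?_⟩,
    h.laplacianControllable_of_isRepeated hN hlast fun f hf v hv => ?_⟩
  · intro v hv
    simpa using hv
  · have := congrFun hf (e ⟨v, hv⟩)
    simpa [Matrix.vecMul, dotProduct] using this

/-- Two vertices of equal degree without input would make the difference of their unit vectors an
eigenvector annihilated by `B`. -/
theorem card_sub_le_of_isTerminal (h : IsCreation G pos s N) {κ : Type*} [Fintype κ]
    {B : Matrix V κ ℝ} (hT : IsTerminal B) (hB : LaplacianControllable G B) :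
    Fintype.card V - (distinctDegrees G).card ≤ Fintype.card κ := by
  choose i hi huniq using hT
  have hunit : ((Finset.univ.image i)ᶜ).card ≤ (distinctDegrees G).card := by
    refine Finset.card_le_card_of_injOn (fun v => G.degree v)
      (fun v _ => Finset.mem_image_of_mem _ (Finset.mem_univ v)) ?_
    intro u hu v hv huv
    simp only [Finset.coe_compl, Finset.coe_image, Finset.coe_univ, Set.image_univ,
      Set.mem_compl_iff, Set.mem_range, not_exists] at hu hv huv
    by_contra hne
    have hzero : ∀ w, (∀ t, i t ≠ w) → ∀ t, B w t = 0 := fun w hw t => by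
      by_contra hwt
      exact hw t (huniq t w hwt).symm
    obtain ⟨μ, hμ⟩ := h.exists_lapMatrix_mulVec_eq_smul (d := G.degree u)
      (f := Pi.single u 1 - Pi.single v 1) (fun w hw => by
        have h1 : w ≠ u := by rintro rfl; exact hw rfl
        have h2 : w ≠ v := by rintro rfl; exact hw huv.symm
        simp [h1, h2]) (by simp [Finset.sum_sub_distrib])
    have := congrFun (hB.eq_zero hμ (by
      ext t
      rw [sub_vecMul, single_one_vecMul, single_one_vecMul]
      simp [hzero u hu, hzero v hv])) u
    simp [hne] at this
  have h1 := Finset.card_add_card_compl (Finset.univ.image i)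
  have h2 : (Finset.univ.image i).card ≤ Fintype.card κ := Finset.card_image_le
  omega

end IsCreation

end ThresholdControl

/-! ### The theorem -/

theorem mainTheorem3 {V : Type*} [Fintype V] [DecidableEq V] (G : SimpleGraph V)
    [DecidableRel G.Adj] (hcard : 2 ≤ Fintype.card V) (hconn : G.Connected)
    (hthr : ThresholdControl.IsThreshold G) :
    -- the row block of each degree class has rank at least `m - 1`
    (∀ (p : ℕ) (B : Matrix V (Fin p) ℝ), ThresholdControl.LaplacianControllable G B →
      ∀ d ∈ ThresholdControl.distinctDegrees G,
        ThresholdControl.degreeMult G d - 1 ≤ (ThresholdControl.degreeBlock G B d).rank) ∧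
    -- these bounds are attained, for all degree classes at once, and for every number of inputs
    -- that allows controllability at all
    (∀ p : ℕ, (∃ B : Matrix V (Fin p) ℝ, ThresholdControl.LaplacianControllable G B) →
      ∃ B : Matrix V (Fin p) ℝ, ThresholdControl.LaplacianControllable G B ∧
        ∀ d ∈ ThresholdControl.distinctDegrees G,
          (ThresholdControl.degreeBlock G B d).rank = ThresholdControl.degreeMult G d - 1) ∧
    -- the maximum multiplicity in the conjugate degree sequence is the largest multiplicity of a
    -- Laplacian eigenvalue
    IsGreatest {m : ℕ | ∃ μ : ℝ,
        Module.End.HasEigenvalue (Matrix.toLin' (G.lapMatrix ℝ)) μ ∧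
          ThresholdControl.lapEigenMult G μ = m}
      (ThresholdControl.maxConjMult G) ∧
    -- it is the minimum number of inputs, for general and for binary control matrices
    IsLeast {p : ℕ | ∃ B : Matrix V (Fin p) ℝ, ThresholdControl.LaplacianControllable G B}
      (ThresholdControl.maxConjMult G) ∧
    IsLeast {p : ℕ | ∃ B : Matrix V (Fin p) ℝ, ThresholdControl.IsBinary B ∧
        ThresholdControl.LaplacianControllable G B}
      (ThresholdControl.maxConjMult G) ∧
    -- the minimum number of inputs for terminal control matrices
    IsLeast {p : ℕ | ∃ B : Matrix V (Fin p) ℝ, ThresholdControl.IsTerminal B ∧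
        ThresholdControl.LaplacianControllable G B}
      (Fintype.card V - (ThresholdControl.distinctDegrees G).card) := by
  obtain ⟨pos, s, N, h, -, hN⟩ := hthr.exists_isCreation hcard
  have hlast := h.step_last hN hconn
  have hmin : ∀ (p : ℕ) (B : Matrix V (Fin p) ℝ), ThresholdControl.LaplacianControllable G B →
      ThresholdControl.maxConjMult G ≤ p := fun p B hB => by
    simpa using h.maxConjMult_le hB
  refine ⟨fun p B hB d _ => h.le_rank_degreeBlock hB d, ?_, h.isGreatest_maxConjMult,
    ⟨⟨_, h.laplacianControllable_offsetMatrix hN hlast le_rfl⟩, ?_⟩,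
    ⟨⟨_, ThresholdControl.isBinary_offsetMatrix pos s N _,
      h.laplacianControllable_offsetMatrix hN hlast le_rfl⟩, ?_⟩,
    ⟨h.exists_isTerminal hN hlast, ?_⟩⟩
  · rintro p ⟨B, hB⟩
    -- Columns of the offset matrix beyond the largest multiplicity are zero, so the same
    -- construction serves every admissible `p`.
    exact ⟨_, h.laplacianControllable_offsetMatrix hN hlast (hmin p B hB),
      fun d hd => h.rank_degreeBlock_offsetMatrix hN hlast (hmin p B hB) hd⟩
  · rintro p ⟨B, hB⟩
    exact hmin p B hB
  · rintro p ⟨B, -, hB⟩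
    exact hmin p B hB
  · rintro p ⟨B, hT, hB⟩
    simpa using h.card_sub_le_of_isTerminal hT hB
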